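/- A *tournament* is an orientation of a finite complete graph. For integers $a,b,c\ge 1$, let $T[a,b,c]$ be the tournament whose vertex set is the disjoint union of parts $A,B,C$ with $|A|=a$, $|B|=b$, $|C|=c$, in which all edges between different parts are directed from $A$ to $B$, from $B$ to $C$ and from $C$ to $A$, and in which each of the three parts induces a transitive tournament. A *tournamenton* is a measurable function $W:[0,1]^2\to[0,1]$ with $W(x,y)+W(y,x)=1$ for all $(x,y)\in[0,1]^2$. It is *regular* if $\int_0^1 W(x,y)\,\mathrm{d}y=\frac12$ for almost every $x\in[0,1]$. For a finite digraph $H$ with vertex set $V(H)$ and edge set $E(H)$, put $$t(H,W)=\int_{[0,1]^{V(H)}}\ \prod_{vw\in E(H)}W(x_v,x_w)\,\mathrm{d}x .$$ **(1)** Let $T$ be a tournament. Then the constant tournamenton $1/2$ is the unique minimizer of $t(T,W)$ among all regular tournamentons $W$ (that is, $t(T,W)\ge t(T,1/2)$ for every regular tournamenton $W$, with equality only if $W=1/2$ almost everywhere) if and only if $T$ is a transitive tournament with at least four vertices or $T$ is isomorphic to $T[a,b,c]$ for some integers $a,b,c\ge1$ with $a+b+c\ge4$. **(2)** Call a tournament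 $T$ *quasirandom forcing in regular tournamentons* if for every regular tournamenton $W$, $t(T,W)=2^{-|E(T)|}$ holds if and only if $W=1/2$ almost everywhere. Every $T[a,b,c]$ with $a,b,c\ge1$ and $a+b+c\ge4$ is a non-transitive tournament that is quasirandom forcing in regular tournamentons. In particular, there are non-transitive tournaments of infinitely many different orders, and hence infinitely many pairwise non-isomorphic ones, that are quasirandom forcing in regular tournamentons. -/

import Mathlib

open MeasureTheory

/-- A tournament: an orientation of a complete graph. There are no loops, and between two distinct
vertices there is an edge in exactly one of the two directions. -/
structure IsTournament {V : Type*} (T : Digraph V) : Prop where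
  loopless : ∀ v, ¬ T.Adj v v
  oriented : ∀ u v, u ≠ v → Xor (T.Adj u v) (T.Adj v u)

/-- A tournament is transitive if its edge relation is transitive. -/
def IsTransitiveDigraph {V : Type*} (T : Digraph V) : Prop :=
  ∀ u v w, T.Adj u v → T.Adj v w → T.Adj u w

/-- Isomorphism of digraphs. -/
def DigraphIso {V V' : Type*} (G : Digraph V) (H : Digraph V') : Prop :=
  Nonempty (G.Adj ≃r H.Adj)

/-- `C[a,b,c]`: the blow-up of the cyclically oriented triangle with independent parts of sizes
`a`, `b`, `c`; all edges go from the `a`-part to the `b`-part, from the `b`-part to the `c`-part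
and from the `c`-part to the `a`-part. -/
def cyclicBlowup (a b c : ℕ) : Digraph (Fin a ⊕ Fin b ⊕ Fin c) where
  Adj
    | .inl _, .inr (.inl _) => True
    | .inr (.inl _), .inr (.inr _) => True
    | .inr (.inr _), .inl _ => True
    | _, _ => False

/-- The disjoint union of transitive tournaments with `a`, `b` and `c` vertices. -/
def transitiveParts (a b c : ℕ) : Digraph (Fin a ⊕ Fin b ⊕ Fin c) where
  Adj
    | .inl i, .inl j => i < j
    | .inr (.inl i), .inr (.inl j) => i < j
    | .inr (.inr i), .inr (.inr j) => i < j
    | _, _ => False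

/-- `T[a,b,c]`: the digraph `C[a,b,c]` with a transitive tournament added on each of its parts. -/
def cyclicTournament (a b c : ℕ) : Digraph (Fin a ⊕ Fin b ⊕ Fin c) where
  Adj u v := (cyclicBlowup a b c).Adj u v ∨ (transitiveParts a b c).Adj u v

/-- A tournamenton: a measurable `W : [0,1]² → [0,1]` with `W(x,y) + W(y,x) = 1` everywhere. -/
structure Tournamenton where
  toFun : unitInterval → unitInterval → ℝ
  measurable' : Measurable fun p : unitInterval × unitInterval => toFun p.1 p.2
  mem_Icc' : ∀ x y, toFun x y ∈ Set.Icc (0 : ℝ) 1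
  add_swap' : ∀ x y, toFun x y + toFun y x = 1

namespace Tournamenton

/-- The constant tournamenton `1/2`. -/
noncomputable def half : Tournamenton where
  toFun _ _ := 1 / 2
  measurable' := measurable_const
  mem_Icc' _ _ := by norm_num
  add_swap' _ _ := by norm_num

/-- Almost everywhere equality of tournamentons. -/
def AEEq (W W' : Tournamenton) : Prop :=
  ∀ᵐ p : unitInterval × unitInterval, W.toFun p.1 p.2 = W'.toFun p.1 p.2

/-- `W` is regular if `∫ W(x,y) dy = 1/2` for almost every `x`. -/
def IsRegular (W : Tournamenton) : Prop :=
  ∀ᵐ x : unitInterval, ∫ y : unitInterval, W.toFun x y = 1 / 2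

end Tournamenton

open Classical in
/-- The edge set of a finite digraph, as a finite set of ordered pairs. -/
noncomputable def digraphEdges {V : Type*} [Fintype V] (H : Digraph V) : Finset (V × V) :=
  Finset.univ.filter fun e => H.Adj e.1 e.2

/-- The homomorphism density `t(H,W)`: the integral over `[0,1]^V` of the product of
`W(x_v, x_w)` over the edges `vw` of `H`. -/
noncomputable def homDensity {V : Type*} [Fintype V] (H : Digraph V) (W : Tournamenton) : ℝ :=
  ∫ x : V → unitInterval, ∏ e ∈ digraphEdges H, W.toFun (x e.1) (x e.2)

/-- `W₀` is, up to almost everywhere equality, the unique minimizer of `t(H,W)` over all regular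
tournamentons `W`. -/
def IsUniqueRegularMinimizer {V : Type*} [Fintype V] (H : Digraph V) (W₀ : Tournamenton) : Prop :=
  W₀.IsRegular ∧
  (∀ W : Tournamenton, W.IsRegular → homDensity H W₀ ≤ homDensity H W) ∧
  (∀ W : Tournamenton, W.IsRegular → homDensity H W = homDensity H W₀ → W.AEEq W₀)

/-- `H` is quasirandom forcing in regular tournamentons: a regular tournamenton `W` satisfies
`t(H,W) = 2^{-|E(H)|}` if and only if `W ≡ 1/2` almost everywhere. -/
def QuasirandomForcingInRegular {V : Type*} [Fintype V] (H : Digraph V) : Prop :=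
  ∀ W : Tournamenton, W.IsRegular →
    (homDensity H W = (1 / 2 : ℝ) ^ (digraphEdges H).card ↔ W.AEEq Tournamenton.half)

/-!
Write a regular tournamenton as a kernel `w` with `w x y + w y x = 1` and all degrees `1 / 2`.

*Lower bound.* A transitive tournament placed on an independent part of a digraph costs a factor of
at most `2` per edge (`lintegral_pow_le_chainWeight`: split off the first vertex and apply Jensen's
inequality to its outdegree), so the density of `T[a,b,c]` is bounded below by that of the blow-up
of the cyclic triangle (`blowupDensity_le_cyclicDensity`). For the blow-up, the vertices `y` of the
second part are fixed. With `T` the density of edges from the common outneighbourhood of `y` to its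
common inneighbourhood, and `d'`, `d` the sizes of these neighbourhoods, Hölder's inequality bounds
the density of the remaining two parts below by a monomial in `T`, `d'`, `d` with exponents
`a * c`, `-c * (a - 1)`, `-a * (c - 1)`. The arithmetic-geometric mean inequality bounds this, after
normalisation and for `c ≤ a`, by a combination of `T`, `d * d'`, `d'` and `1`. Let `κ x z` be the
density of paths of length two from `x` to `z`. In a regular kernel `κ` is symmetric, so the
averages of `2 * T` and of `d * d'` over `y` are both `∫ κ ^ b`, the average of `d'` is constant,
and the bound becomes `∫ (4 * κ) ^ b ≥ 1`, which holds since `κ` has mean `1 / 4`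
(`mul_lintegral_pathDensity_pow_le`). A rotation of the parts gives `c ≤ a` and `2 ≤ b`. For `2 ≤ b`
equality forces `κ = 1 / 4` almost everywhere, and then `w = 1 / 2` almost everywhere, because the
first two moments of the degrees from any set are those of the constant
(`ae_eq_half_of_pathDensity`). A transitive tournament on at least four vertices is `T[n,2,0]` with
`n ≥ 2`, where codegrees take the place of `κ`.

*Converse.* If `1 / 2` is a minimizer, then the density of `T` is positive in every regular
tournamenton. On a compact group, orienting pairs by their difference gives regular tournamentons
(`exists_tournamenton_of_group`). On the circle only locally transitive tournaments have positive
density; on sequences over `ZMod 3`, oriented by the first place where they differ, only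
tournaments that decompose as a blow-up of the cyclic triangle, possibly with an empty part. A
tournament with both properties has transitive parts, hence is transitive or some `T[a,b,c]`.
Those with at most three vertices have the same density in all regular tournamentons.
-/

open scoped ENNReal

/-! ### Pointwise and integral convexity inequalities -/

/-- The tangent-line form of convexity of `x ↦ x ^ n` at `y`, homogenised. -/
theorem Real.succ_mul_pow_mul_le (n : ℕ) {x y : ℝ} (hx : 0 ≤ x) (hy : 0 ≤ y) :
    (n + 1) * (y ^ n * x) ≤ x ^ (n + 1) + n * y ^ (n + 1) := by
  induction n with
  | zero => simp
  | succ n ih =>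
    have h1 := mul_le_mul_of_nonneg_left ih hy
    have h2 : 0 ≤ (x - y) * (x ^ (n + 1) - y ^ (n + 1)) := by
      rcases le_total x y with h | h
      · exact mul_nonneg_of_nonpos_of_nonpos (by linarith)
          (by linarith [pow_le_pow_left₀ hx h (n + 1)])
      · exact mul_nonneg (by linarith) (by linarith [pow_le_pow_left₀ hy h (n + 1)])
    push_cast
    linear_combination h1 + h2

theorem ENNReal.succ_mul_pow_mul_le (n : ℕ) {x y : ℝ≥0∞} (hx : x ≠ ∞) (hy : y ≠ ∞) :
    (n + 1) * (y ^ n * x) ≤ x ^ (n + 1) + n * y ^ (n + 1) := by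
  lift x to NNReal using hx
  lift y to NNReal using hy
  norm_cast
  have := Real.succ_mul_pow_mul_le n x.2 y.2
  exact_mod_cast this

/-- Jensen's inequality for `x ↦ x ^ (n + 1)` and the weight `u`, cleared of denominators. -/
theorem lintegral_mul_pow_succ_le {Ω : Type*} [MeasurableSpace Ω] {μ : Measure Ω}
    [IsProbabilityMeasure μ] {u g : Ω → ℝ≥0∞} (hu : Measurable u) (hg : Measurable g)
    (hu1 : ∀ x, u x ≤ 1) (hg1 : ∀ x, g x ≤ 1) (n : ℕ) :
    (∫⁻ x, u x * g x ∂μ) ^ (n + 1) ≤ (∫⁻ x, u x ∂μ) ^ n * ∫⁻ x, u x * g x ^ (n + 1) ∂μ := by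
  set U := ∫⁻ x, u x ∂μ with hU
  set G := ∫⁻ x, u x * g x ∂μ with hG
  have hGU : G ≤ U := lintegral_mono fun x => mul_le_of_le_one_right' (hg1 x)
  have hU1 : U ≤ 1 := by
    calc U ≤ ∫⁻ _, 1 ∂μ := lintegral_mono hu1
      _ = 1 := by simp
  have hUt : U ≠ ∞ := ne_top_of_le_ne_top ENNReal.one_ne_top hU1
  have hGt : G ≠ ∞ := ne_top_of_le_ne_top hUt hGU
  rcases eq_or_ne U 0 with h0 | h0
  · have : G = 0 := le_antisymm (h0 ▸ hGU) bot_le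
    simp [this]
  have key : ∀ x, (n + 1) * (G ^ n * U) * (u x * g x) ≤
      U ^ (n + 1) * (u x * g x ^ (n + 1)) + n * G ^ (n + 1) * u x := by
    intro x
    have hgt : g x ≠ ∞ := ne_top_of_le_ne_top ENNReal.one_ne_top (hg1 x)
    have := ENNReal.succ_mul_pow_mul_le n (x := U * g x) (y := G) (ENNReal.mul_ne_top hUt hgt) hGt
    calc (n + 1) * (G ^ n * U) * (u x * g x) = u x * ((n + 1) * (G ^ n * (U * g x))) := by ring
      _ ≤ u x * ((U * g x) ^ (n + 1) + n * G ^ (n + 1)) := by gcongr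
      _ = _ := by ring
  have h := lintegral_mono (μ := μ) key
  rw [lintegral_const_mul _ (by fun_prop), lintegral_add_left (by fun_prop),
    lintegral_const_mul _ (by fun_prop), lintegral_const_mul _ (by fun_prop), ← hU, ← hG] at h
  have h' : U * G ^ (n + 1) + n * G ^ (n + 1) * U ≤
      U * (U ^ n * ∫⁻ x, u x * g x ^ (n + 1) ∂μ) + n * G ^ (n + 1) * U := by
    calc _ = (n + 1) * (G ^ n * U) * G := by ring
      _ ≤ _ := h
      _ = _ := by ring
  have hfin : (n : ℝ≥0∞) * G ^ (n + 1) * U ≠ ∞ := by finiteness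
  exact (ENNReal.mul_le_mul_iff_right h0 hUt).1 ((ENNReal.add_le_add_iff_right hfin).1 h')

section Power

variable {α : Type*} [MeasureSpace α] [IsProbabilityMeasure (volume : Measure α)]

theorem lintegral_fin_succ {n : ℕ} {F : (Fin (n + 1) → α) → ℝ≥0∞} (hF : Measurable F) :
    ∫⁻ x, F x = ∫⁻ v : α, ∫⁻ x : Fin n → α, F (Fin.cons v x) := by
  have hcons : Measurable fun p : α × (Fin n → α) => (Fin.cons p.1 p.2 : Fin (n + 1) → α) := by
    refine measurable_pi_lambda _ fun i => ?_
    cases i using Fin.cases with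
    | zero => exact measurable_fst
    | succ i => exact (measurable_pi_apply i).comp measurable_snd
  rw [← ((volume_preserving_piFinSuccAbove (fun _ : Fin (n + 1) => α) 0).symm).lintegral_comp_emb
    (MeasurableEquiv.measurableEmbedding _), Measure.volume_eq_prod,
    ← lintegral_prod (fun p : α × (Fin n → α) => F (Fin.cons p.1 p.2))
      (hF.comp hcons).aemeasurable]
  refine lintegral_congr fun p => ?_
  congr 1
  funext i
  cases i using Fin.cases <;> rfl

theorem lintegral_pi_prod_eq_pow {f : α → ℝ≥0∞} (hf : Measurable f) (n : ℕ) :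
    ∫⁻ x : Fin n → α, ∏ i, f (x i) = (∫⁻ x, f x) ^ n := by
  induction n with
  | zero => simp
  | succ n ih =>
    rw [lintegral_fin_succ (by fun_prop)]
    simp only [Fin.prod_univ_succ, Fin.cons_zero, Fin.cons_succ]
    have hm : Measurable fun x : Fin n → α => ∏ i, f (x i) := by fun_prop
    simp_rw [lintegral_const_mul _ hm]
    rw [pow_succ', lintegral_mul_const _ hf, ih]

end Power

/-! ### Densities of transitive tournaments and of blow-ups of the cyclic triangle -/

/-- The analogue of a tournamenton with values in `ℝ≥0∞`, on an arbitrary measurable space. -/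
structure IsTournamentKernel {α : Type*} [MeasurableSpace α] (w : α → α → ℝ≥0∞) : Prop where
  measurable : Measurable fun p : α × α => w p.1 p.2
  add_swap : ∀ x y, w x y + w y x = 1

/-- The product of `w` over the edges of the transitive tournament on the points `x i`. -/
noncomputable def chainWeight {α : Type*} (w : α → α → ℝ≥0∞) {n : ℕ} (x : Fin n → α) : ℝ≥0∞ :=
  ∏ i, ∏ j, if i < j then w (x i) (x j) else 1

/-- The product of `w` over all edges directed from the points `x i` to the points `y j`. -/
noncomputable def crossWeight {α : Type*} (w : α → α → ℝ≥0∞) {m n : ℕ} (x : Fin m → α)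
    (y : Fin n → α) : ℝ≥0∞ :=
  ∏ i, ∏ j, w (x i) (y j)

section Weights

variable {α : Type*} {w : α → α → ℝ≥0∞}

theorem chainWeight_cons {n : ℕ} (v : α) (x : Fin n → α) :
    chainWeight w (Fin.cons v x : Fin (n + 1) → α) = (∏ j, w v (x j)) * chainWeight w x := by
  simp [chainWeight, Fin.prod_univ_succ]

theorem crossWeight_comm_prod {m n : ℕ} (x : Fin m → α) (y : Fin n → α) :
    crossWeight w x y = ∏ j, ∏ i, w (x i) (y j) :=
  Finset.prod_comm

theorem prod_le_one_of_le_one {ι : Type*} {s : Finset ι} {f : ι → ℝ≥0∞} (h : ∀ i, f i ≤ 1) :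
    ∏ i ∈ s, f i ≤ 1 :=
  Finset.prod_le_one' fun i _ => h i

theorem lintegral_le_one {Ω : Type*} [MeasurableSpace Ω] {μ : Measure Ω} [IsProbabilityMeasure μ]
    {f : Ω → ℝ≥0∞} (hf : ∀ x, f x ≤ 1) : ∫⁻ x, f x ∂μ ≤ 1 := by
  calc ∫⁻ x, f x ∂μ ≤ ∫⁻ _, 1 ∂μ := lintegral_mono hf
    _ = 1 := by simp

end Weights

namespace IsTournamentKernel

variable {α : Type*} [MeasureSpace α]
  {w : α → α → ℝ≥0∞} (hw : IsTournamentKernel w)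

include hw

theorem le_one (x y : α) : w x y ≤ 1 := hw.add_swap x y ▸ le_self_add

theorem measurable_comp {β : Type*} [MeasurableSpace β] {f g : β → α} (hf : Measurable f)
    (hg : Measurable g) : Measurable fun b => w (f b) (g b) :=
  hw.measurable.comp (hf.prodMk hg)

theorem measurable_chainWeight {β : Type*} [MeasurableSpace β] {n : ℕ} {f : β → Fin n → α}
    (hf : Measurable f) : Measurable fun b => chainWeight w (f b) := by
  unfold chainWeight
  refine Finset.measurable_fun_prod _ fun i _ => Finset.measurable_fun_prod _ fun j _ => ?_
  split_ifs
  · exact hw.measurable_comp (by fun_prop) (by fun_prop)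
  · exact measurable_const

theorem measurable_crossWeight {β : Type*} [MeasurableSpace β] {m n : ℕ} {f : β → Fin m → α}
    {g : β → Fin n → α} (hf : Measurable f) (hg : Measurable g) :
    Measurable fun b => crossWeight w (f b) (g b) := by
  unfold crossWeight
  refine Finset.measurable_fun_prod _ fun i _ => Finset.measurable_fun_prod _ fun j _ => ?_
  exact hw.measurable_comp (by fun_prop) (by fun_prop)

theorem measurable_left (v : α) : Measurable fun x => w v x :=
  hw.measurable_comp (by fun_prop) (by fun_prop)

theorem measurable_right (v : α) : Measurable fun x => w x v :=
  hw.measurable_comp (by fun_prop) (by fun_prop)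

variable [IsProbabilityMeasure (volume : Measure α)]

theorem two_mul_lintegral_lintegral {u : α → ℝ≥0∞} (hu : Measurable u) :
    2 * ∫⁻ v, u v * ∫⁻ x, u x * w v x = (∫⁻ x, u x) ^ 2 := by
  have m1 : ∀ v, Measurable fun x => u x * w v x :=
    fun v => hu.mul (hw.measurable_left v)
  have m2 : Measurable fun p : α × α => u p.1 * (u p.2 * w p.1 p.2) :=
    (hu.comp measurable_fst).mul ((hu.comp measurable_snd).mul hw.measurable)
  have m3 : Measurable fun v => ∫⁻ x, u v * (u x * w v x) := m2.lintegral_prod_right'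
  have e1 : ∫⁻ v, u v * ∫⁻ x, u x * w v x = ∫⁻ v, ∫⁻ x, u v * (u x * w v x) := by
    refine lintegral_congr fun v => ?_
    rw [lintegral_const_mul _ (m1 v)]
  have e2 : ∫⁻ v, ∫⁻ x, u v * (u x * w v x) = ∫⁻ v, ∫⁻ x, u v * (u x * w x v) := by
    rw [lintegral_lintegral_swap m2.aemeasurable]
    refine lintegral_congr fun v => lintegral_congr fun x => ?_
    ring
  have e3 : ∀ v, (∫⁻ x, u v * (u x * w v x)) + ∫⁻ x, u v * (u x * w x v) =
      u v * ∫⁻ x, u x := by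
    intro v
    have mv := m1 v
    rw [← lintegral_add_left (by fun_prop), ← lintegral_const_mul _ hu]
    refine lintegral_congr fun x => ?_
    rw [← mul_add, ← mul_add, hw.add_swap, mul_one]
  rw [two_mul, e1]
  nth_rewrite 2 [e2]
  rw [← lintegral_add_left m3]
  simp_rw [e3]
  rw [lintegral_mul_const _ hu, sq]

theorem lintegral_chainWeight_succ {n : ℕ} {u : α → ℝ≥0∞} (hu : Measurable u) :
    ∫⁻ x : Fin (n + 1) → α, chainWeight w x * ∏ i, u (x i) =
      ∫⁻ v, u v * ∫⁻ x : Fin n → α, chainWeight w x * ∏ i, (u (x i) * w v (x i)) := by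
  have mc : ∀ k, Measurable fun x : Fin k → α => chainWeight w x :=
    fun k => hw.measurable_chainWeight measurable_id
  have mc1 := mc (n + 1)
  have mc0 := mc n
  rw [lintegral_fin_succ (by fun_prop)]
  refine lintegral_congr fun v => ?_
  have m : Measurable fun x => u x * w v x :=
    hu.mul (hw.measurable_comp (by fun_prop) (by fun_prop))
  have mp : Measurable fun x : Fin n → α => ∏ i, (u (x i) * w v (x i)) :=
    Finset.measurable_fun_prod _ fun i _ => m.comp (measurable_pi_apply i)
  rw [← lintegral_const_mul _ (by fun_prop)]
  refine lintegral_congr fun x => ?_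
  rw [chainWeight_cons, Fin.prod_univ_succ, Finset.prod_mul_distrib]
  simp only [Fin.cons_zero, Fin.cons_succ]
  ring

/-- A weighted density of the transitive tournament on `n` vertices is at least what it would be
if `w` were `1 / 2` everywhere: the first vertex is split off, and Jensen's inequality is applied
to its weighted outdegree, whose mean does not depend on `w`. -/
theorem lintegral_pow_le_chainWeight (n : ℕ) {u : α → ℝ≥0∞} (hu : Measurable u)
    (hu1 : ∀ x, u x ≤ 1) :
    (∫⁻ x, u x) ^ n ≤
      2 ^ n.choose 2 * ∫⁻ x : Fin n → α, chainWeight w x * ∏ i, u (x i) := by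
  induction n generalizing u with
  | zero => simp [chainWeight]
  | succ n ih =>
    have m1 : ∀ v, Measurable fun x => u x * w v x :=
      fun v => hu.mul (hw.measurable_comp (by fun_prop) (by fun_prop))
    set g : α → ℝ≥0∞ := fun v => ∫⁻ x, u x * w v x with hg
    have mg : Measurable g :=
      Measurable.lintegral_prod_right' (f := fun p : α × α => u p.2 * w p.1 p.2)
        ((hu.comp measurable_snd).mul hw.measurable)
    have hu1' : ∀ v x, u x * w v x ≤ 1 := fun v x => mul_le_one' (hu1 x) (hw.le_one v x)
    have hg1 : ∀ v, g v ≤ 1 := fun v => lintegral_le_one (hu1' v)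
    have hU1 : ∫⁻ x, u x ≤ 1 := lintegral_le_one hu1
    have step : ∫⁻ v, u v * g v ^ n ≤
        2 ^ n.choose 2 * ∫⁻ x : Fin (n + 1) → α, chainWeight w x * ∏ i, u (x i) := by
      rw [hw.lintegral_chainWeight_succ hu, ← lintegral_const_mul' _ _ (by finiteness)]
      refine lintegral_mono fun v => ?_
      calc u v * g v ^ n ≤ u v * (2 ^ n.choose 2 *
            ∫⁻ x : Fin n → α, chainWeight w x * ∏ i, (u (x i) * w v (x i))) := by
            gcongr
            exact ih (m1 v) (hu1' v)
        _ = _ := by ring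
    rcases n with - | m
    · simpa using step
    have hJ := lintegral_mul_pow_succ_le (μ := volume) hu mg hu1 hg1 m
    have hS := hw.two_mul_lintegral_lintegral hu
    set U := ∫⁻ x, u x with hU
    rcases eq_or_ne U 0 with h0 | h0
    · simp [h0]
    have hUt : U ≠ ∞ := ne_top_of_le_ne_top ENNReal.one_ne_top hU1
    have h1 : U ^ m * U ^ (m + 1 + 1) ≤ U ^ m * (2 ^ (m + 1) * ∫⁻ v, u v * g v ^ (m + 1)) := by
      calc U ^ m * U ^ (m + 1 + 1) = (U ^ 2) ^ (m + 1) := by ring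
        _ = 2 ^ (m + 1) * (∫⁻ v, u v * g v) ^ (m + 1) := by rw [← hS, mul_pow]
        _ ≤ 2 ^ (m + 1) * (U ^ m * ∫⁻ v, u v * g v ^ (m + 1)) := by gcongr
        _ = _ := by ring
    have h2 := (ENNReal.mul_le_mul_iff_right (pow_ne_zero m h0) (by finiteness)).1 h1
    calc U ^ (m + 1 + 1) ≤ 2 ^ (m + 1) * ∫⁻ v, u v * g v ^ (m + 1) := h2
      _ ≤ 2 ^ (m + 1) * (2 ^ (m + 1).choose 2 *
          ∫⁻ x : Fin (m + 1 + 1) → α, chainWeight w x * ∏ i, u (x i)) := by gcongr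
      _ = _ := by rw [Nat.choose_succ_succ' (m + 1) 1, Nat.choose_one_right, pow_add]; ring

/-- For two vertices the bound of `lintegral_pow_le_chainWeight` is an equality. -/
theorem two_mul_lintegral_chainWeight_two {u : α → ℝ≥0∞} (hu : Measurable u) :
    2 * ∫⁻ x : Fin 2 → α, chainWeight w x * ∏ i, u (x i) = (∫⁻ x, u x) ^ 2 := by
  rw [hw.lintegral_chainWeight_succ hu, ← hw.two_mul_lintegral_lintegral hu]
  congr 1
  refine lintegral_congr fun v => ?_
  congr 1
  have m : Measurable fun x => u x * w v x :=
    hu.mul (hw.measurable_comp (by fun_prop) (by fun_prop))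
  have : ∀ x : Fin 1 → α, chainWeight w x = 1 := fun x => by simp [chainWeight]
  simp_rw [this, one_mul]
  rw [lintegral_pi_prod_eq_pow m, pow_one]

/-- Hölder's inequality for a weighted blow-up of an edge: `p` and `q` are the vertex weights of
the two sides. -/
theorem lintegral_pow_mul_le_crossWeight (a c : ℕ) {p q : α → ℝ≥0∞} (hp : Measurable p)
    (hq : Measurable q) (hp1 : ∀ x, p x ≤ 1) (hq1 : ∀ x, q x ≤ 1) :
    (∫⁻ z, p z * ∫⁻ x, q x * w z x) ^ ((a + 1) * (c + 1)) ≤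
      (∫⁻ z, p z) ^ ((c + 1) * a) * (∫⁻ x, q x) ^ ((a + 1) * c) *
        ∫⁻ z : Fin (c + 1) → α, (∏ j, p (z j)) *
          (∫⁻ x, q x * ∏ j, w (z j) x) ^ (a + 1) := by
  set m : α → ℝ≥0∞ := fun x => ∫⁻ z, p z * w z x with hm
  have mpw : Measurable fun y : α × α => p y.2 * w y.2 y.1 :=
    (hp.comp measurable_snd).mul (hw.measurable_comp measurable_snd measurable_fst)
  have mm : Measurable m := mpw.lintegral_prod_right'
  have hm1 : ∀ x, m x ≤ 1 := fun x => lintegral_le_one fun z => mul_le_one' (hp1 z) (hw.le_one z x)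
  set g : (Fin (c + 1) → α) → ℝ≥0∞ := fun z => ∫⁻ x, q x * ∏ j, w (z j) x with hg
  have mW : Measurable fun y : (Fin (c + 1) → α) × α => ∏ j, w (y.1 j) y.2 :=
    Finset.measurable_fun_prod _ fun j _ => hw.measurable_comp (by fun_prop) (by fun_prop)
  have mgg : Measurable fun y : (Fin (c + 1) → α) × α => q y.2 * ∏ j, w (y.1 j) y.2 :=
    (hq.comp measurable_snd).mul mW
  have mg : Measurable g := mgg.lintegral_prod_right'
  have hW1 : ∀ (z : Fin (c + 1) → α) x, ∏ j, w (z j) x ≤ 1 :=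
    fun z x => prod_le_one_of_le_one fun j => hw.le_one _ _
  have hg1 : ∀ z, g z ≤ 1 := fun z => lintegral_le_one fun x => mul_le_one' (hq1 x) (hW1 z x)
  have mP : Measurable fun z : Fin (c + 1) → α => ∏ j, p (z j) := by fun_prop
  -- The edge density, and the density of a star with its centre on the `q`-side.
  have e1 : ∫⁻ z, p z * ∫⁻ x, q x * w z x = ∫⁻ x, q x * m x := by
    have h1 : ∀ z, p z * ∫⁻ x, q x * w z x = ∫⁻ x, p z * (q x * w z x) := fun z =>
      (lintegral_const_mul _ (hq.mul (hw.measurable_comp (by fun_prop) (by fun_prop)))).symm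
    have h2 : ∀ x, q x * m x = ∫⁻ z, q x * (p z * w z x) := fun x =>
      (lintegral_const_mul _ (hp.mul (hw.measurable_comp (by fun_prop) (by fun_prop)))).symm
    simp_rw [h1, h2]
    rw [lintegral_lintegral_swap]
    · refine lintegral_congr fun x => lintegral_congr fun z => ?_
      ring
    · exact ((hp.comp measurable_fst).mul
        ((hq.comp measurable_snd).mul hw.measurable)).aemeasurable
  have e2 : ∫⁻ x, q x * m x ^ (c + 1) = ∫⁻ z : Fin (c + 1) → α, (∏ j, p (z j)) * g z := by
    have h1 : ∀ x, q x * m x ^ (c + 1) =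
        ∫⁻ z : Fin (c + 1) → α, q x * ∏ j, (p (z j) * w (z j) x) := fun x => by
      have mx : Measurable fun z => p z * w z x :=
        hp.mul (hw.measurable_comp (by fun_prop) (by fun_prop))
      rw [hm, ← lintegral_pi_prod_eq_pow mx, lintegral_const_mul]
      exact Finset.measurable_fun_prod _ fun j _ => mx.comp (measurable_pi_apply j)
    have h2 : ∀ z : Fin (c + 1) → α, (∏ j, p (z j)) * g z =
        ∫⁻ x, (∏ j, p (z j)) * (q x * ∏ j, w (z j) x) := fun z =>
      (lintegral_const_mul _ (mgg.comp measurable_prodMk_left)).symm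
    simp_rw [h1, h2]
    rw [lintegral_lintegral_swap]
    · refine lintegral_congr fun x => lintegral_congr fun z => ?_
      rw [Finset.prod_mul_distrib]
      ring
    · refine Measurable.aemeasurable ?_
      refine (hq.comp measurable_fst).mul (Finset.measurable_fun_prod _ fun j _ => ?_)
      exact (hp.comp (by fun_prop)).mul (hw.measurable_comp (by fun_prop) (by fun_prop))
  have J1 := lintegral_mul_pow_succ_le (μ := volume) hq mm hq1 hm1 c
  have J2 := lintegral_mul_pow_succ_le (μ := volume) mP mg
    (fun z => prod_le_one_of_le_one fun j => hp1 _) hg1 a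
  rw [lintegral_pi_prod_eq_pow hp, ← e2] at J2
  calc (∫⁻ z, p z * ∫⁻ x, q x * w z x) ^ ((a + 1) * (c + 1))
      = ((∫⁻ x, q x * m x) ^ (c + 1)) ^ (a + 1) := by rw [e1, ← pow_mul, mul_comm (a + 1)]
    _ ≤ ((∫⁻ x, q x) ^ c * ∫⁻ x, q x * m x ^ (c + 1)) ^ (a + 1) := by gcongr
    _ = (∫⁻ x, q x) ^ ((a + 1) * c) * (∫⁻ x, q x * m x ^ (c + 1)) ^ (a + 1) := by
        rw [mul_pow, ← pow_mul, mul_comm c]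
    _ ≤ (∫⁻ x, q x) ^ ((a + 1) * c) * (((∫⁻ z, p z) ^ (c + 1)) ^ a *
          ∫⁻ z : Fin (c + 1) → α, (∏ j, p (z j)) * g z ^ (a + 1)) := by gcongr
    _ = _ := by rw [← pow_mul]; ring

end IsTournamentKernel

/-! ### The arithmetic-geometric mean inequality and power means -/

theorem NNReal.mul_le_of_pow_le {n k l r : ℕ} (hn : 1 + k + l + r = n) {t s e d : NNReal}
    (h : t ^ n ≤ s * e ^ k * d ^ l) : n * t ≤ s + k * e + l * d + r := by
  have hn0 : n ≠ 0 := by omega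
  have hnR : (n : NNReal) ≠ 0 := by exact_mod_cast hn0
  have key := NNReal.geom_mean_le_arith_mean4_weighted (1 / n) (k / n) (l / n) (r / n) s e d 1
    (by rw [← add_div, ← add_div, ← add_div, div_eq_one_iff_eq hnR]; exact_mod_cast hn)
  have h1 : t ≤ s ^ ((1 / n : NNReal) : ℝ) * e ^ ((k / n : NNReal) : ℝ) *
      d ^ ((l / n : NNReal) : ℝ) * 1 ^ ((r / n : NNReal) : ℝ) := by
    have h2 := NNReal.rpow_le_rpow h (z := (1 / n : ℝ)) (by positivity)
    rw [← NNReal.rpow_natCast t, ← NNReal.rpow_mul, mul_one_div_cancel (by exact_mod_cast hn0),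
      NNReal.rpow_one, NNReal.mul_rpow, NNReal.mul_rpow, ← NNReal.rpow_natCast e,
      ← NNReal.rpow_natCast d, ← NNReal.rpow_mul, ← NNReal.rpow_mul] at h2
    push_cast
    simpa [div_eq_mul_inv] using h2
  have h3 := mul_le_mul_of_nonneg_left (h1.trans key) (zero_le : 0 ≤ (n : NNReal))
  refine h3.trans (le_of_eq ?_)
  field_simp

/-- The weighted arithmetic-geometric mean inequality for `s`, `k` copies of `e`, `l` copies of `d`
and `r` copies of `1`. -/
theorem ENNReal.mul_le_of_pow_le {n k l r : ℕ} (hn : 1 + k + l + r = n) {t s e d : ℝ≥0∞}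
    (ht : t ≠ ∞) (hs : s ≠ ∞) (he : e ≠ ∞) (hd : d ≠ ∞)
    (h : t ^ n ≤ s * e ^ k * d ^ l) : n * t ≤ s + k * e + l * d + r := by
  lift t to NNReal using ht
  lift s to NNReal using hs
  lift e to NNReal using he
  lift d to NNReal using hd
  norm_cast at h ⊢
  exact NNReal.mul_le_of_pow_le hn h

theorem ENNReal.eq_one_of_pow_add_eq {n : ℕ} {x : ℝ≥0∞} (hx : x ≠ ∞)
    (h : x ^ (n + 2) + (n + 1) = (n + 2) * x) : x = 1 := by
  lift x to NNReal using hx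
  norm_cast at h ⊢
  have hR : (x : ℝ) ^ (n + 2) + (n + 1) = (n + 2) * x := by exact_mod_cast h
  have h1 := Real.succ_mul_pow_mul_le n x.2 zero_le_one
  have h2 : (x : ℝ) * ((n + 1) * (1 ^ n * x)) ≤ x * (x ^ (n + 1) + n * 1 ^ (n + 1)) :=
    mul_le_mul_of_nonneg_left h1 x.2
  have h3 : (n + 1) * ((x : ℝ) - 1) ^ 2 ≤ 0 := by
    simp only [one_pow, one_mul, mul_one] at h2
    linear_combination h2 + hR
  have h4 : ((x : ℝ) - 1) ^ 2 = 0 :=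
    le_antisymm (nonpos_of_mul_nonpos_right h3 (by positivity)) (sq_nonneg _)
  have h5 : (x : ℝ) = 1 := by linarith [pow_eq_zero_iff (two_ne_zero) |>.1 h4]
  exact_mod_cast h5

section PowerMean

variable {Ω : Type*} [MeasurableSpace Ω] {μ : Measure Ω} [IsProbabilityMeasure μ] {h : Ω → ℝ≥0∞}

theorem one_le_lintegral_pow (hm : Measurable h) (hf : ∀ x, h x ≠ ∞) (h1 : ∫⁻ x, h x ∂μ = 1)
    (n : ℕ) : 1 ≤ ∫⁻ x, h x ^ (n + 1) ∂μ := by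
  have key : ∀ x, (n + 1) * h x ≤ h x ^ (n + 1) + n := fun x => by
    simpa using ENNReal.succ_mul_pow_mul_le n (hf x) ENNReal.one_ne_top
  have := lintegral_mono (μ := μ) key
  rw [lintegral_const_mul _ hm, lintegral_add_left (by fun_prop), h1, lintegral_const,
    measure_univ, mul_one, mul_one, add_comm] at this
  exact (ENNReal.add_le_add_iff_right (ENNReal.natCast_ne_top n)).1 this

theorem ae_eq_one_of_lintegral_pow_le (hm : Measurable h) (hf : ∀ x, h x ≠ ∞)
    (h1 : ∫⁻ x, h x ∂μ = 1) (n : ℕ) (hle : ∫⁻ x, h x ^ (n + 2) ∂μ ≤ 1) : ∀ᵐ x ∂μ, h x = 1 := by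
  have key : ∀ x, (n + 2) * h x ≤ h x ^ (n + 2) + (n + 1) := fun x => by
    have := ENNReal.succ_mul_pow_mul_le (n + 1) (hf x) ENNReal.one_ne_top
    simpa [add_assoc, one_add_one_eq_two] using this
  have hae := ae_eq_of_ae_le_of_lintegral_le (μ := μ) (Filter.Eventually.of_forall key)
    (by rw [lintegral_const_mul _ hm, h1]; finiteness) (by fun_prop) (by
      rw [lintegral_const_mul _ hm, lintegral_add_left (by fun_prop), h1, lintegral_const,
        measure_univ, mul_one, mul_one]
      calc _ ≤ (1 : ℝ≥0∞) + (n + 1) := by gcongr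
        _ = n + 2 := by ring)
  filter_upwards [hae] with x hx
  exact ENNReal.eq_one_of_pow_add_eq (hf x) hx.symm

end PowerMean

/-! ### Path densities in regular kernels -/

/-- The density of the blow-up of the cyclic triangle with independent parts of sizes `a`, `b`,
`c`, with the vertices of the first part integrated out. -/
noncomputable def blowupDensity {α : Type*} [MeasureSpace α] (w : α → α → ℝ≥0∞) (a b c : ℕ) :
    ℝ≥0∞ :=
  ∫⁻ y : Fin b → α, ∫⁻ z : Fin c → α, (∏ j, ∏ i, w (y i) (z j)) *
    (∫⁻ x, (∏ i, w x (y i)) * ∏ j, w (z j) x) ^ a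

/-- The density of directed paths with two edges from `x` to `z`. -/
noncomputable def pathDensity {α : Type*} [MeasureSpace α] (w : α → α → ℝ≥0∞) (x z : α) : ℝ≥0∞ :=
  ∫⁻ y, w x y * w y z

namespace IsTournamentKernel

variable {α : Type*} [MeasureSpace α] {w : α → α → ℝ≥0∞} (hw : IsTournamentKernel w)

include hw

theorem pathDensity_add_right (x z : α) :
    pathDensity w x z + ∫⁻ y, w x y * w z y = ∫⁻ y, w x y := by
  have m1 := hw.measurable_left x
  have m2 := hw.measurable_right z
  rw [pathDensity, ← lintegral_add_left (by fun_prop)]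
  refine lintegral_congr fun y => ?_
  rw [← mul_add, hw.add_swap, mul_one]

theorem pathDensity_add_left (x z : α) :
    pathDensity w x z + ∫⁻ y, w y x * w y z = ∫⁻ y, w y z := by
  have m1 := hw.measurable_left x
  have m2 := hw.measurable_right z
  rw [pathDensity, ← lintegral_add_left (by fun_prop)]
  refine lintegral_congr fun y => ?_
  rw [← add_mul, hw.add_swap, one_mul]

variable [IsProbabilityMeasure (volume : Measure α)]

theorem lintegral_right_add_left (x : α) : (∫⁻ y, w x y) + ∫⁻ y, w y x = 1 := by
  rw [← lintegral_add_left (hw.measurable_left x)]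
  simp [hw.add_swap]

theorem measurable_pathDensity : Measurable fun p : α × α => pathDensity w p.1 p.2 := by
  refine Measurable.lintegral_prod_right' (f := fun q : (α × α) × α => w q.1.1 q.2 * w q.2 q.1.2) ?_
  exact (hw.measurable_comp (by fun_prop) (by fun_prop)).mul
    (hw.measurable_comp (by fun_prop) (by fun_prop))

theorem pathDensity_le_one (x z : α) : pathDensity w x z ≤ 1 :=
  lintegral_le_one fun _ => mul_le_one' (hw.le_one _ _) (hw.le_one _ _)

section Regular

variable (hr : ∀ᵐ x : α, ∫⁻ y, w x y = 2⁻¹)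

include hr

theorem ae_lintegral_left : ∀ᵐ x : α, ∫⁻ y, w y x = 2⁻¹ := by
  filter_upwards [hr] with x hx
  have h := hw.lintegral_right_add_left x
  rw [hx] at h
  refine (ENNReal.add_right_inj (a := 2⁻¹) (by simp)).1 ?_
  rw [h, ENNReal.inv_two_add_inv_two]

theorem pathDensity_comm_ae : ∀ᵐ p : α × α, pathDensity w p.1 p.2 = pathDensity w p.2 p.1 := by
  have h1 : ∀ᵐ p : α × α, ∫⁻ y, w p.1 y = 2⁻¹ :=
    Measure.quasiMeasurePreserving_fst.ae hr
  have h2 : ∀ᵐ p : α × α, ∫⁻ y, w p.2 y = 2⁻¹ :=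
    Measure.quasiMeasurePreserving_snd.ae hr
  filter_upwards [h1, h2] with p hp1 hp2
  have e1 := hw.pathDensity_add_right p.1 p.2
  have e2 := hw.pathDensity_add_right p.2 p.1
  rw [hp1] at e1
  rw [hp2] at e2
  have e3 : ∫⁻ y, w p.1 y * w p.2 y = ∫⁻ y, w p.2 y * w p.1 y := by simp_rw [mul_comm]
  have hfin : ∫⁻ y, w p.2 y * w p.1 y ≠ ∞ := ne_top_of_le_ne_top ENNReal.one_ne_top
    (lintegral_le_one fun _ => mul_le_one' (hw.le_one _ _) (hw.le_one _ _))
  rw [e3] at e1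
  exact (ENNReal.add_left_inj hfin).1 (e1.trans e2.symm)

theorem lintegral_pathDensity : ∫⁻ p : α × α, 4 * pathDensity w p.1 p.2 = 1 := by
  have hl := hw.ae_lintegral_left hr
  rw [lintegral_const_mul _ hw.measurable_pathDensity]
  have : ∫⁻ p : α × α, pathDensity w p.1 p.2 = ∫⁻ y, (∫⁻ x, w x y) * ∫⁻ z, w y z := by
    have m : Measurable fun q : (α × α) × α => w q.1.1 q.2 * w q.2 q.1.2 :=
      (hw.measurable_comp (by fun_prop) (by fun_prop)).mul
        (hw.measurable_comp (by fun_prop) (by fun_prop))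
    simp only [pathDensity]
    rw [lintegral_lintegral_swap m.aemeasurable]
    refine lintegral_congr fun y => ?_
    rw [Measure.volume_eq_prod, lintegral_prod_mul (hw.measurable_right y).aemeasurable
      (hw.measurable_left y).aemeasurable]
  rw [this, lintegral_congr_ae (g := fun _ => 4⁻¹)]
  · simp [ENNReal.mul_inv_cancel]
  · filter_upwards [hr, hl] with y h1 h2
    rw [h1, h2, ← ENNReal.mul_inv (by simp) (by simp)]
    norm_num

theorem lintegral_mul_pathDensity_pow (b : ℕ) :
    2 * ∫⁻ p : α × α, w p.2 p.1 * pathDensity w p.1 p.2 ^ b =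
      ∫⁻ p : α × α, pathDensity w p.1 p.2 ^ b := by
  have mk := hw.measurable_pathDensity
  have m1 : Measurable fun p : α × α => w p.2 p.1 :=
    hw.measurable_comp measurable_snd measurable_fst
  have m2 := hw.measurable
  have hswap : ∫⁻ p : α × α, w p.2 p.1 * pathDensity w p.1 p.2 ^ b =
      ∫⁻ p : α × α, w p.1 p.2 * pathDensity w p.1 p.2 ^ b := by
    rw [Measure.volume_eq_prod, ← lintegral_prod_swap]
    refine lintegral_congr_ae ?_
    filter_upwards [hw.pathDensity_comm_ae hr] with p hp
    simp [hp]
  rw [two_mul]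
  nth_rewrite 1 [hswap]
  rw [← lintegral_add_left (by fun_prop)]
  refine lintegral_congr fun p => ?_
  rw [← add_mul, hw.add_swap, one_mul]

end Regular

end IsTournamentKernel

/-! ### The lower bound for blow-ups of the cyclic triangle -/

namespace IsTournamentKernel

variable {α : Type*} [MeasureSpace α] [IsProbabilityMeasure (volume : Measure α)]
  {w : α → α → ℝ≥0∞} (hw : IsTournamentKernel w)

include hw

theorem lintegral_lintegral_prod_path (b : ℕ) {F : α × α → ℝ≥0∞} (hF : Measurable F) :
    ∫⁻ y : Fin b → α, ∫⁻ p : α × α, F p * ((∏ i, w p.1 (y i)) * ∏ i, w (y i) p.2) =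
      ∫⁻ p : α × α, F p * pathDensity w p.1 p.2 ^ b := by
  have m : Measurable fun q : (Fin b → α) × (α × α) =>
      F q.2 * ((∏ i, w q.2.1 (q.1 i)) * ∏ i, w (q.1 i) q.2.2) := by
    refine (hF.comp measurable_snd).mul (Measurable.mul ?_ ?_)
    all_goals
      exact Finset.measurable_fun_prod _ fun i _ => hw.measurable_comp (by fun_prop) (by fun_prop)
  rw [lintegral_lintegral_swap m.aemeasurable]
  refine lintegral_congr fun p => ?_
  have mp : Measurable fun y => w p.1 y * w y p.2 :=
    (hw.measurable_left p.1).mul (hw.measurable_right p.2)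
  rw [pathDensity, ← lintegral_pi_prod_eq_pow mp, ← lintegral_const_mul]
  · simp_rw [Finset.prod_mul_distrib]
  · exact Finset.measurable_fun_prod _ fun i _ => mp.comp (measurable_pi_apply i)

/-- The lower bound for blow-ups of the cyclic triangle. With the second part `y` fixed, let `T` be
the density of edges from the common outneighbourhood of `y` to its common inneighbourhood. Hölder's
inequality bounds the contribution of `y` from below by a monomial in `T` and the two neighbourhood
sizes, with negative exponents in the sizes, and this monomial is bounded from below by its
tangent at the values taken by the constant `1 / 2`. Averaged over `y`, the terms of the tangent are
multiples of `1` and of the `b`-th moment of the path density, because the path density is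
symmetric. -/
theorem mul_lintegral_pathDensity_pow_le (hr : ∀ᵐ x : α, ∫⁻ y, w x y = 2⁻¹) (c l b : ℕ) :
    (c + l + 1) * ∫⁻ p : α × α, (4 * pathDensity w p.1 p.2) ^ b ≤
      2 ^ ((c + l + 1) * (c + 1) + (c + l + 1) * b + b * (c + 1)) *
        blowupDensity w (c + l + 1) b (c + 1) + (c + l) := by
  set P : (Fin b → α) → α → ℝ≥0∞ := fun y z => ∏ i, w (y i) z with hP
  set Q : (Fin b → α) → α → ℝ≥0∞ := fun y x => ∏ i, w x (y i) with hQ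
  have mP2 : Measurable fun q : (Fin b → α) × α => P q.1 q.2 :=
    Finset.measurable_fun_prod _ fun i _ => hw.measurable_comp (by fun_prop) (by fun_prop)
  have mQ2 : Measurable fun q : (Fin b → α) × α => Q q.1 q.2 :=
    Finset.measurable_fun_prod _ fun i _ => hw.measurable_comp (by fun_prop) (by fun_prop)
  have mP : ∀ y, Measurable (P y) := fun y => mP2.comp measurable_prodMk_left
  have mQ : ∀ y, Measurable (Q y) := fun y => mQ2.comp measurable_prodMk_left
  have P1 : ∀ y z, P y z ≤ 1 := fun y z => prod_le_one_of_le_one fun i => hw.le_one _ _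
  have Q1 : ∀ y z, Q y z ≤ 1 := fun y z => prod_le_one_of_le_one fun i => hw.le_one _ _
  set A : (Fin b → α) → ℝ≥0∞ := fun y => ∫⁻ z, P y z with hA
  set B : (Fin b → α) → ℝ≥0∞ := fun y => ∫⁻ x, Q y x with hB
  set T : (Fin b → α) → ℝ≥0∞ := fun y => ∫⁻ z, P y z * ∫⁻ x, Q y x * w z x with hT
  set S : (Fin b → α) → ℝ≥0∞ := fun y => ∫⁻ z : Fin (c + 1) → α, (∏ j, P y (z j)) *
    (∫⁻ x, Q y x * ∏ j, w (z j) x) ^ (c + l + 1) with hS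
  have mA : Measurable A := mP2.lintegral_prod_right'
  have mB : Measurable B := mQ2.lintegral_prod_right'
  have mQw : ∀ y z, Measurable fun x => Q y x * w z x := fun y z => by
    have := mQ y
    have := hw.measurable_left z
    fun_prop
  have hT' : ∀ y, T y = ∫⁻ p : α × α, w p.2 p.1 * (Q y p.1 * P y p.2) := fun y => by
    have mm : Measurable fun p : α × α => w p.2 p.1 * (Q y p.1 * P y p.2) :=
      (hw.measurable_comp measurable_snd measurable_fst).mul
        (((mQ y).comp measurable_fst).mul ((mP y).comp measurable_snd))
    rw [Measure.volume_eq_prod, lintegral_prod_symm _ mm.aemeasurable]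
    refine lintegral_congr fun z => ?_
    rw [← lintegral_const_mul _ (mQw y z)]
    refine lintegral_congr fun x => ?_
    ring
  have hAB : ∀ y, A y * B y = ∫⁻ p : α × α, 1 * (Q y p.1 * P y p.2) := fun y => by
    simp_rw [one_mul]
    rw [Measure.volume_eq_prod, lintegral_prod_mul (mQ y).aemeasurable (mP y).aemeasurable,
      mul_comm]
  have mT : Measurable T := by
    simp_rw [funext hT']
    refine Measurable.lintegral_prod_right'
      (f := fun q : (Fin b → α) × (α × α) => w q.2.2 q.2.1 * (Q q.1 q.2.1 * P q.1 q.2.2)) ?_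
    exact (hw.measurable_comp (by fun_prop) (by fun_prop)).mul
      ((mQ2.comp (measurable_fst.prodMk (measurable_fst.comp measurable_snd))).mul
        (mP2.comp (measurable_fst.prodMk (measurable_snd.comp measurable_snd))))
  have A1 : ∀ y, A y ≤ 1 := fun y => lintegral_le_one (P1 y)
  have B1 : ∀ y, B y ≤ 1 := fun y => lintegral_le_one (Q1 y)
  have T1 : ∀ y, T y ≤ 1 := fun y => lintegral_le_one fun z => mul_le_one' (P1 y z)
    (lintegral_le_one fun x => mul_le_one' (Q1 y x) (hw.le_one _ _))
  have S1 : ∀ y, S y ≤ 1 := fun y => lintegral_le_one fun z => mul_le_one'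
    (prod_le_one_of_le_one fun j => P1 y _)
    (pow_le_one' (lintegral_le_one fun x => mul_le_one' (Q1 y x)
      (prod_le_one_of_le_one fun j => hw.le_one _ _)) _)
  have fin1 : ∀ {r : ℝ≥0∞}, r ≤ 1 → r ≠ ∞ := fun h => ne_top_of_le_ne_top ENNReal.one_ne_top h
  set N := (c + l + 1) * (c + 1) + (c + l + 1) * b + b * (c + 1) with hN
  have key : ∀ y, (((c + l + 1) * (c + 1) : ℕ) : ℝ≥0∞) * (2 ^ (2 * b + 1) * T y) ≤
      2 ^ N * S y + ((c + l + 1) * c : ℕ) * (2 ^ b * A y * (2 ^ b * B y)) + l * (2 ^ b * A y) +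
        c := by
    intro y
    have fA := fin1 (A1 y)
    have fB := fin1 (B1 y)
    have fS := fin1 (S1 y)
    have fT := fin1 (T1 y)
    refine ENNReal.mul_le_of_pow_le (by ring) (by finiteness) (by finiteness) (by finiteness)
      (by finiteness) ?_
    calc (2 ^ (2 * b + 1) * T y) ^ ((c + l + 1) * (c + 1))
        = 2 ^ ((2 * b + 1) * ((c + l + 1) * (c + 1))) * T y ^ ((c + l + 1) * (c + 1)) := by
          rw [mul_pow, ← pow_mul]
      _ ≤ 2 ^ ((2 * b + 1) * ((c + l + 1) * (c + 1))) * (A y ^ ((c + 1) * (c + l)) *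
            B y ^ ((c + l + 1) * c) * S y) := by
          gcongr
          exact hw.lintegral_pow_mul_le_crossWeight (c + l) c (mP y) (mQ y) (P1 y) (Q1 y)
      _ = _ := by
          rw [hN]
          ring
  have hint := lintegral_mono (μ := volume) key
  have iT : 2 * ∫⁻ y, T y = ∫⁻ p : α × α, pathDensity w p.1 p.2 ^ b := by
    simp_rw [hT']
    rw [hw.lintegral_lintegral_prod_path b (hw.measurable_comp measurable_snd measurable_fst),
      hw.lintegral_mul_pathDensity_pow hr]
  have iAB : ∫⁻ y, A y * B y = ∫⁻ p : α × α, pathDensity w p.1 p.2 ^ b := by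
    simp_rw [hAB]
    rw [hw.lintegral_lintegral_prod_path b measurable_const]
    simp
  have iA : 2 ^ b * ∫⁻ y, A y = 1 := by
    rw [hA, lintegral_lintegral_swap mP2.aemeasurable]
    simp_rw [hP, lintegral_pi_prod_eq_pow (hw.measurable_right _)]
    rw [lintegral_congr_ae (g := fun _ => 2⁻¹ ^ b)]
    · simp [← mul_pow, ENNReal.mul_inv_cancel]
    · filter_upwards [hw.ae_lintegral_left hr] with z hz
      rw [hz]
  have iS : ∫⁻ y, S y = blowupDensity w (c + l + 1) b (c + 1) := rfl
  set D := ∫⁻ p : α × α, pathDensity w p.1 p.2 ^ b with hD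
  have eD : ∫⁻ p : α × α, (4 * pathDensity w p.1 p.2) ^ b = 4 ^ b * D := by
    simp_rw [mul_pow]
    rw [lintegral_const_mul _ (hw.measurable_pathDensity.pow_const b)]
  have h4 : (2 : ℝ≥0∞) ^ (2 * b) = 4 ^ b := by rw [pow_mul]; norm_num
  rw [lintegral_const_mul _ (by fun_prop), lintegral_const_mul _ mT,
    lintegral_add_right _ measurable_const, lintegral_add_right _ (by fun_prop),
    lintegral_add_right _ (by fun_prop), lintegral_const_mul' _ _ (by finiteness), iS,
    lintegral_const_mul _ (by fun_prop), lintegral_const_mul _ (by fun_prop),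
    lintegral_const_mul _ (by fun_prop), iA, lintegral_const, measure_univ] at hint
  have e1 : ∫⁻ y, 2 ^ b * A y * (2 ^ b * B y) = 4 ^ b * D := by
    rw [← iAB, ← lintegral_const_mul _ (by fun_prop), ← h4]
    refine lintegral_congr fun y => ?_
    ring
  rw [e1] at hint
  have fD : D ≠ ∞ := fin1 (lintegral_le_one fun p => pow_le_one' (hw.pathDensity_le_one _ _) _)
  rw [eD]
  have ffin : (((c + l + 1) * c : ℕ) : ℝ≥0∞) * (4 ^ b * D) ≠ ∞ := by finiteness
  refine (ENNReal.add_le_add_iff_right ffin).1 ?_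
  calc (c + l + 1) * (4 ^ b * D) + (((c + l + 1) * c : ℕ) : ℝ≥0∞) * (4 ^ b * D)
      = (((c + l + 1) * (c + 1) : ℕ) : ℝ≥0∞) * (2 ^ (2 * b + 1) * ∫⁻ y, T y) := by
        rw [pow_succ, mul_assoc (2 ^ (2 * b)), iT, h4]
        push_cast
        ring
    _ ≤ _ := hint
    _ = _ := by
        push_cast
        ring

/-! ### Codegrees and the equality case -/

theorem blowupDensity_two_zero (a : ℕ) : 4 ^ a * blowupDensity w a 2 0 =
    ∫⁻ p : α × α, (4 * ∫⁻ x, w x p.1 * w x p.2) ^ a := by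
  have m : Measurable fun p : α × α => ∫⁻ x, w x p.1 * w x p.2 := by
    refine Measurable.lintegral_prod_right'
      (f := fun q : (α × α) × α => w q.2 q.1.1 * w q.2 q.1.2) ?_
    exact (hw.measurable_comp (by fun_prop) (by fun_prop)).mul
      (hw.measurable_comp (by fun_prop) (by fun_prop))
  simp_rw [mul_pow]
  rw [lintegral_const_mul _ (m.pow_const a)]
  congr 1
  rw [← (volume_preserving_finTwoArrow α).lintegral_comp_emb
    (MeasurableEquiv.measurableEmbedding _)]
  simp [blowupDensity, MeasurableEquiv.finTwoArrow]

section Regular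

variable (hr : ∀ᵐ x : α, ∫⁻ y, w x y = 2⁻¹)

include hr

/-- Paths from `x` to `z` are complementary, within the inneighbourhood of `z`, to common
inneighbours of `x` and `z`, and likewise for outneighbours. -/
theorem ae_pathDensity_add_codegree : ∀ᵐ p : α × α,
    4 * pathDensity w p.1 p.2 + 4 * ∫⁻ x, w x p.1 * w x p.2 = 2 ∧
      4 * pathDensity w p.1 p.2 + 4 * ∫⁻ y, w p.1 y * w p.2 y = 2 := by
  have h1 : ∀ᵐ p : α × α, ∫⁻ x, w x p.2 = 2⁻¹ :=
    Measure.quasiMeasurePreserving_snd.ae (hw.ae_lintegral_left hr)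
  have h2 : ∀ᵐ p : α × α, ∫⁻ x, w p.1 x = 2⁻¹ :=
    Measure.quasiMeasurePreserving_fst.ae hr
  have e : (4 : ℝ≥0∞) * 2⁻¹ = 2 := by
    rw [show (4 : ℝ≥0∞) = 2 * 2 by norm_num, mul_assoc,
      ENNReal.mul_inv_cancel (by simp) (by simp), mul_one]
  filter_upwards [h1, h2] with p hp1 hp2
  rw [← mul_add, hw.pathDensity_add_left, hp1, ← mul_add, hw.pathDensity_add_right, hp2]
  exact ⟨e, e⟩

theorem lintegral_codegree_left : ∫⁻ p : α × α, 4 * ∫⁻ x, w x p.1 * w x p.2 = 1 := by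
  have mk := hw.measurable_pathDensity
  have h := lintegral_congr_ae ((hw.ae_pathDensity_add_codegree hr).mono fun _ hp => hp.1)
  rw [lintegral_add_left (by fun_prop), hw.lintegral_pathDensity hr, lintegral_const, measure_univ,
    mul_one] at h
  exact (ENNReal.add_right_inj ENNReal.one_ne_top).1 (h.trans one_add_one_eq_two.symm)

/-- If almost all pairs of vertices are joined by the expected number of paths, then `w` is
`1 / 2` almost everywhere: for a measurable set `s`, the first two moments of the degree from `s`
force it to be almost constant, so `w` has the right integral on every rectangle. -/
theorem ae_eq_half_of_pathDensity (hk : ∀ᵐ p : α × α, 4 * pathDensity w p.1 p.2 = 1) :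
    ∀ᵐ p : α × α, w p.1 p.2 = 2⁻¹ := by
  have hco : ∀ᵐ p : α × α, 4 * ∫⁻ y, w p.1 y * w p.2 y = 1 := by
    filter_upwards [hk, hw.ae_pathDensity_add_codegree hr] with p h1 ⟨_, h2⟩
    rw [h1] at h2
    exact (ENNReal.add_right_inj ENNReal.one_ne_top).1 (h2.trans one_add_one_eq_two.symm)
  have h2w : ∀ x, ∀ y, 2 * w x y ≤ 2 := fun x y => mul_le_of_le_one_right' (hw.le_one x y)
  have m2w : Measurable fun p : α × α => 2 * w p.1 p.2 := hw.measurable.const_mul 2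
  have m2w' : Measurable fun p : α × α => 2 * w p.2 p.1 := m2w.comp measurable_swap
  have hrow : ∀ᵐ x : α, ∫⁻ y, 2 * w x y = 1 := by
    filter_upwards [hr] with x hx
    rw [lintegral_const_mul _ (hw.measurable_left x), hx, ENNReal.mul_inv_cancel (by simp) (by simp)]
  have hset : ∀ s : Set α, MeasurableSet s →
      ∀ᵐ y : α, ∫⁻ x in s, 2 * w x y = (volume : Measure α) s := by
    intro s hs
    set H : α → ℝ≥0∞ := fun y => ∫⁻ x in s, 2 * w x y with hH
    set V := (volume : Measure α) s with hV
    have mH : Measurable H :=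
      m2w'.lintegral_prod_right'
    rcases eq_or_ne V 0 with h0 | h0
    · refine Filter.Eventually.of_forall fun y => ?_
      rw [h0, Measure.restrict_eq_zero.2 h0, lintegral_zero_measure]
    have hVt : V ≠ ∞ := measure_ne_top _ _
    have i1 : ∫⁻ y, H y = V := by
      rw [hH, lintegral_lintegral_swap m2w'.aemeasurable,
        lintegral_congr_ae (ae_restrict_of_ae hrow)]
      simp [hV]
    have i2 : ∫⁻ y, H y ^ 2 = V ^ 2 := by
      have e : ∀ y, H y ^ 2 = ∫⁻ p in s ×ˢ s, 4 * (w p.1 y * w p.2 y) := fun y => by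
        have m1 : Measurable fun x => 2 * w x y := (hw.measurable_right y).const_mul 2
        rw [sq, hH, Measure.volume_eq_prod, ← Measure.prod_restrict,
          ← lintegral_prod_mul m1.aemeasurable m1.aemeasurable]
        refine lintegral_congr fun p => ?_
        ring
      have m3 : Measurable fun q : α × (α × α) => 4 * (w q.2.1 q.1 * w q.2.2 q.1) :=
        ((hw.measurable_comp (by fun_prop) (by fun_prop)).mul
          (hw.measurable_comp (by fun_prop) (by fun_prop))).const_mul 4
      simp_rw [e]
      rw [lintegral_lintegral_swap m3.aemeasurable]
      have hco' : ∀ᵐ p : α × α ∂(volume.restrict (s ×ˢ s)),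
          ∫⁻ y, 4 * (w p.1 y * w p.2 y) = 1 := by
        refine ae_restrict_of_ae ?_
        filter_upwards [hco] with p hp
        have m1 := hw.measurable_left p.1
        have m2 := hw.measurable_left p.2
        rw [lintegral_const_mul _ (by fun_prop), hp]
      rw [lintegral_congr_ae hco', lintegral_const, Measure.restrict_apply_univ,
        Measure.volume_eq_prod, Measure.prod_prod, one_mul, sq]
    have hone := ae_eq_one_of_lintegral_pow_le (μ := volume) (h := fun y => V⁻¹ * H y)
      (by fun_prop) (fun y => ?_) ?_ 0 ?_
    · filter_upwards [hone] with y hy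
      rw [← mul_one V, ← hy, ← mul_assoc, ENNReal.mul_inv_cancel h0 hVt, one_mul]
    · refine ENNReal.mul_ne_top (by simpa using h0) (ne_top_of_le_ne_top (b := 2 * V)
        (by finiteness) ?_)
      calc H y ≤ ∫⁻ _ in s, 2 := lintegral_mono fun x => h2w x y
        _ = 2 * V := by simp [hV]
    · rw [lintegral_const_mul _ mH, i1, ENNReal.inv_mul_cancel h0 hVt]
    · simp_rw [zero_add, mul_pow]
      rw [lintegral_const_mul _ (mH.pow_const 2), i2, ← mul_pow, ENNReal.inv_mul_cancel h0 hVt,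
        one_pow]
  have hprod : (volume : Measure α).prod volume =
      (volume : Measure (α × α)).withDensity fun p => 2 * w p.1 p.2 := by
    refine Measure.prod_eq fun s t hs ht => ?_
    rw [withDensity_apply _ (hs.prod ht), Measure.volume_eq_prod, ← Measure.prod_restrict,
      lintegral_prod_symm _ m2w.aemeasurable, lintegral_congr_ae (ae_restrict_of_ae (hset s hs)),
      lintegral_const, Measure.restrict_apply_univ]
  have hae : (fun p : α × α => 2 * w p.1 p.2) =ᵐ[volume] fun _ => 1 := by
    refine (withDensity_eq_iff m2w.aemeasurable aemeasurable_const ?_).1 ?_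
    · refine ne_top_of_le_ne_top (b := 2) (by simp) ?_
      calc ∫⁻ p : α × α, 2 * w p.1 p.2 ≤ ∫⁻ _ : α × α, 2 := lintegral_mono fun p => h2w _ _
        _ = 2 := by simp
    · rw [← hprod]
      exact withDensity_one.symm
  filter_upwards [hae] with p hp
  rw [← one_mul (w _ _), ← ENNReal.inv_mul_cancel (a := 2) (by simp) (by simp), mul_assoc, hp,
    mul_one]

end Regular

end IsTournamentKernel

/-! ### The density of `T[a,b,c]` -/

/-- The density of a digraph on three parts, of sizes `a`, `b`, `c`, where all edges between
different parts are present and directed cyclically, and the weights `f`, `g`, `h` account for the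
edges inside the parts. -/
noncomputable def partsDensity {α : Type*} [MeasureSpace α] (w : α → α → ℝ≥0∞) {a b c : ℕ}
    (f : (Fin a → α) → ℝ≥0∞) (g : (Fin b → α) → ℝ≥0∞) (h : (Fin c → α) → ℝ≥0∞) : ℝ≥0∞ :=
  ∫⁻ x : Fin a → α, ∫⁻ y : Fin b → α, ∫⁻ z : Fin c → α,
    f x * g y * h z * (crossWeight w x y * crossWeight w y z * crossWeight w z x)

/-- The density of the tournament `T[a,b,c]`. -/
noncomputable def cyclicDensity {α : Type*} [MeasureSpace α] (w : α → α → ℝ≥0∞) (a b c : ℕ) :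
    ℝ≥0∞ :=
  partsDensity w (chainWeight w : (Fin a → α) → ℝ≥0∞) (chainWeight w : (Fin b → α) → ℝ≥0∞)
    (chainWeight w : (Fin c → α) → ℝ≥0∞)

/-- The number of edges of the tournament `T[a,b,c]`. -/
def cyclicEdges (a b c : ℕ) : ℕ :=
  a.choose 2 + b.choose 2 + c.choose 2 + (a * b + b * c + c * a)

theorem chainWeight_half {α : Type*} {n : ℕ} (x : Fin n → α) :
    chainWeight (fun _ _ => 2⁻¹) x = 2⁻¹ ^ n.choose 2 := by
  induction n with
  | zero => simp [chainWeight]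
  | succ n ih =>
    rw [← Fin.cons_self_tail x, chainWeight_cons, ih, Nat.choose_succ_succ' n 1, pow_add]
    simp

theorem cyclicDensity_half {α : Type*} [MeasureSpace α] [IsProbabilityMeasure (volume : Measure α)]
    (a b c : ℕ) : cyclicDensity (fun _ _ : α => 2⁻¹) a b c = 2⁻¹ ^ cyclicEdges a b c := by
  simp [cyclicDensity, partsDensity, chainWeight_half, crossWeight, cyclicEdges, ← pow_mul, pow_add,
    mul_comm]

theorem lintegral_lintegral_lintegral_rotate {X Y Z : Type*} [MeasureSpace X] [MeasureSpace Y]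
    [MeasureSpace Z] [SFinite (volume : Measure X)] [SFinite (volume : Measure Y)]
    [SFinite (volume : Measure Z)] {F : X → Y → Z → ℝ≥0∞}
    (hF : Measurable fun p : X × Y × Z => F p.1 p.2.1 p.2.2) :
    ∫⁻ x, ∫⁻ y, ∫⁻ z, F x y z = ∫⁻ y, ∫⁻ z, ∫⁻ x, F x y z := by
  have h1 : ∀ x, ∫⁻ y, ∫⁻ z, F x y z = ∫⁻ q : Y × Z, F x q.1 q.2 := fun x => by
    rw [Measure.volume_eq_prod, lintegral_prod]
    exact (hF.comp measurable_prodMk_left).aemeasurable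
  have h2 : Measurable fun q : Y × Z => ∫⁻ x, F x q.1 q.2 :=
    Measurable.lintegral_prod_right' (f := fun r : (Y × Z) × X => F r.2 r.1.1 r.1.2)
      (hF.comp measurable_swap)
  simp_rw [h1]
  rw [lintegral_lintegral_swap hF.aemeasurable, Measure.volume_eq_prod,
    lintegral_prod _ h2.aemeasurable]

theorem lintegral_fin_one {α : Type*} [MeasureSpace α] [SigmaFinite (volume : Measure α)] (F : α → ℝ≥0∞) : ∫⁻ y : Fin 1 → α, F (y 0) = ∫⁻ y, F y :=
  (volume_preserving_funUnique (Fin 1) α).lintegral_comp_emb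
    (MeasurableEquiv.measurableEmbedding _) F

namespace IsTournamentKernel

variable {α : Type*} [MeasureSpace α] {w : α → α → ℝ≥0∞} (hw : IsTournamentKernel w)

include hw

section Parts

variable {a b c : ℕ} {f : (Fin a → α) → ℝ≥0∞} {g : (Fin b → α) → ℝ≥0∞} {h : (Fin c → α) → ℝ≥0∞}

/-- The last part integrated out. -/
theorem partsDensity_eq (hf : Measurable f) :
    partsDensity w g h f = ∫⁻ y, ∫⁻ z, g y * h z * crossWeight w y z *
      ∫⁻ x, f x * ∏ i, ((∏ j, w (x i) (y j)) * ∏ j, w (z j) (x i)) := by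
  refine lintegral_congr fun y => lintegral_congr fun z => ?_
  rw [← lintegral_const_mul]
  · refine lintegral_congr fun x => ?_
    rw [Finset.prod_mul_distrib, crossWeight_comm_prod z x, crossWeight, crossWeight]
    ring
  · refine hf.mul (Finset.measurable_fun_prod _ fun i _ => Measurable.mul ?_ ?_)
    all_goals
      exact Finset.measurable_fun_prod _ fun i _ => hw.measurable_comp (by fun_prop) (by fun_prop)

theorem measurable_link (y : Fin b → α) (z : Fin c → α) :
    Measurable fun x => (∏ j, w x (y j)) * ∏ j, w (z j) x := by
  refine Measurable.mul ?_ ?_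
  all_goals
    exact Finset.measurable_fun_prod _ fun i _ => hw.measurable_comp (by fun_prop) (by fun_prop)

variable [IsProbabilityMeasure (volume : Measure α)]

theorem partsDensity_rotate (hf : Measurable f) (hg : Measurable g) (hh : Measurable h) :
    partsDensity w f g h = partsDensity w g h f := by
  rw [partsDensity, lintegral_lintegral_lintegral_rotate]
  · refine lintegral_congr fun y => lintegral_congr fun z => lintegral_congr fun x => ?_
    ring
  · refine (((hf.comp measurable_fst).mul (hg.comp (measurable_fst.comp measurable_snd))).mul
      (hh.comp (measurable_snd.comp measurable_snd))).mul ?_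
    exact ((hw.measurable_crossWeight (by fun_prop) (by fun_prop)).mul
      (hw.measurable_crossWeight (by fun_prop) (by fun_prop))).mul
      (hw.measurable_crossWeight (by fun_prop) (by fun_prop))

/-- Putting a transitive tournament on an independent part decreases the density by a factor of at
most `2` per new edge. -/
theorem partsDensity_one_le :
    partsDensity w g h (fun _ : Fin a → α => 1) ≤
      2 ^ a.choose 2 * partsDensity w g h (chainWeight w : (Fin a → α) → ℝ≥0∞) := by
  rw [hw.partsDensity_eq measurable_const,
    hw.partsDensity_eq (f := chainWeight w) (hw.measurable_chainWeight measurable_id),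
    ← lintegral_const_mul' _ _ (by finiteness)]
  refine lintegral_mono fun y => ?_
  simp only []
  rw [← lintegral_const_mul' _ _ (by finiteness)]
  refine lintegral_mono fun z => ?_
  simp only [one_mul]
  rw [lintegral_pi_prod_eq_pow (hw.measurable_link y z), mul_left_comm]
  gcongr
  exact hw.lintegral_pow_le_chainWeight a (hw.measurable_link y z) fun x =>
    mul_le_one' (prod_le_one_of_le_one fun _ => hw.le_one _ _)
      (prod_le_one_of_le_one fun _ => hw.le_one _ _)

end Parts

variable [IsProbabilityMeasure (volume : Measure α)]

theorem cyclicDensity_rotate (a b c : ℕ) : cyclicDensity w a b c = cyclicDensity w b c a :=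
  hw.partsDensity_rotate (hw.measurable_chainWeight measurable_id)
    (hw.measurable_chainWeight measurable_id) (hw.measurable_chainWeight measurable_id)

theorem blowupDensity_eq_partsDensity (a b c : ℕ) : blowupDensity w a b c =
    partsDensity w (fun _ : Fin b → α => 1) (fun _ : Fin c → α => 1) (fun _ : Fin a → α => 1) := by
  rw [hw.partsDensity_eq measurable_const]
  refine lintegral_congr fun y => lintegral_congr fun z => ?_
  simp only [one_mul]
  rw [lintegral_pi_prod_eq_pow (hw.measurable_link y z), crossWeight_comm_prod]

theorem blowupDensity_le_cyclicDensity (a b c : ℕ) : blowupDensity w a b c ≤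
    2 ^ (a.choose 2 + b.choose 2 + c.choose 2) * cyclicDensity w a b c := by
  have m : ∀ n, Measurable (chainWeight w : (Fin n → α) → ℝ≥0∞) :=
    fun n => hw.measurable_chainWeight measurable_id
  calc blowupDensity w a b c
      ≤ 2 ^ a.choose 2 * partsDensity w (fun _ : Fin b → α => 1) (fun _ : Fin c → α => 1)
          (chainWeight w : (Fin a → α) → ℝ≥0∞) := by
        rw [hw.blowupDensity_eq_partsDensity]
        exact hw.partsDensity_one_le
    _ = 2 ^ a.choose 2 * partsDensity w (fun _ : Fin c → α => 1)
          (chainWeight w : (Fin a → α) → ℝ≥0∞) (fun _ : Fin b → α => 1) := by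
        rw [hw.partsDensity_rotate measurable_const measurable_const (m a)]
    _ ≤ 2 ^ a.choose 2 * (2 ^ b.choose 2 * partsDensity w (fun _ : Fin c → α => 1)
          (chainWeight w : (Fin a → α) → ℝ≥0∞) (chainWeight w : (Fin b → α) → ℝ≥0∞)) := by
        gcongr
        exact hw.partsDensity_one_le
    _ = 2 ^ a.choose 2 * (2 ^ b.choose 2 * partsDensity w (chainWeight w : (Fin a → α) → ℝ≥0∞)
          (chainWeight w : (Fin b → α) → ℝ≥0∞) (fun _ : Fin c → α => 1)) := by
        rw [hw.partsDensity_rotate measurable_const (m a) (m b)]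
    _ ≤ 2 ^ a.choose 2 * (2 ^ b.choose 2 * (2 ^ c.choose 2 * cyclicDensity w a b c)) := by
        gcongr
        exact hw.partsDensity_one_le
    _ = _ := by ring

theorem lintegral_codegree_pow_le_cyclicDensity (n : ℕ) :
    ∫⁻ p : α × α, (4 * ∫⁻ x, w x p.1 * w x p.2) ^ n ≤
      2 ^ cyclicEdges n 2 0 * cyclicDensity w n 2 0 := by
  rw [← hw.blowupDensity_two_zero]
  calc 4 ^ n * blowupDensity w n 2 0
      ≤ 4 ^ n * (2 ^ (n.choose 2 + (2).choose 2 + (0).choose 2) * cyclicDensity w n 2 0) := by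
        gcongr
        exact hw.blowupDensity_le_cyclicDensity n 2 0
    _ = _ := by
        rw [← mul_assoc, show (4 : ℝ≥0∞) = 2 ^ 2 by norm_num, ← pow_mul, ← pow_add, cyclicEdges]
        congr 2
        ring

theorem codegree_left_ne_top (p : α × α) : 4 * ∫⁻ x, w x p.1 * w x p.2 ≠ ∞ :=
  ENNReal.mul_ne_top (by simp) (ne_top_of_le_ne_top ENNReal.one_ne_top
    (lintegral_le_one fun _ => mul_le_one' (hw.le_one _ _) (hw.le_one _ _)))

theorem measurable_codegree_left :
    Measurable fun p : α × α => 4 * ∫⁻ x, w x p.1 * w x p.2 :=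
  (Measurable.lintegral_prod_right' (f := fun q : (α × α) × α => w q.2 q.1.1 * w q.2 q.1.2)
    ((hw.measurable_comp (by fun_prop) (by fun_prop)).mul
      (hw.measurable_comp (by fun_prop) (by fun_prop)))).const_mul 4

theorem two_pow_mul_lintegral_chainWeight {n : ℕ} (hn : n ≤ 2) {u : α → ℝ≥0∞}
    (hu : Measurable u) : 2 ^ n.choose 2 * ∫⁻ x : Fin n → α, chainWeight w x * ∏ i, u (x i) =
      (∫⁻ x, u x) ^ n := by
  interval_cases n
  · simp [chainWeight]
  · have : ∀ x : Fin 1 → α, chainWeight w x = 1 := fun x => by simp [chainWeight]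
    simp_rw [this, one_mul]
    rw [lintegral_pi_prod_eq_pow hu]
    simp
  · simpa using hw.two_mul_lintegral_chainWeight_two hu

theorem two_pow_mul_cyclicDensity {a b c : ℕ} (ha : a ≤ 2) (hb : b ≤ 1) (hc : c ≤ 1) :
    2 ^ a.choose 2 * cyclicDensity w a b c = blowupDensity w a b c := by
  have h1 : ∀ {n : ℕ}, n ≤ 1 → (chainWeight w : (Fin n → α) → ℝ≥0∞) = fun _ => 1 := by
    intro n hn
    funext x
    interval_cases n <;> simp [chainWeight]
  have m : ∀ n, Measurable (chainWeight w : (Fin n → α) → ℝ≥0∞) :=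
    fun n => hw.measurable_chainWeight measurable_id
  rw [cyclicDensity, hw.partsDensity_rotate (m a) (m b) (m c), h1 hb,
    h1 hc, hw.blowupDensity_eq_partsDensity,
    hw.partsDensity_eq (m a), hw.partsDensity_eq measurable_const, ← lintegral_const_mul' _ _ (by finiteness)]
  refine lintegral_congr fun y => ?_
  rw [← lintegral_const_mul' _ _ (by finiteness)]
  refine lintegral_congr fun z => ?_
  rw [mul_left_comm, hw.two_pow_mul_lintegral_chainWeight ha (hw.measurable_link y z)]
  simp_rw [one_mul]
  rw [lintegral_pi_prod_eq_pow (hw.measurable_link y z)]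

section Regular

variable (hr : ∀ᵐ x : α, ∫⁻ y, w x y = 2⁻¹)

include hr

theorem lintegral_pathDensity_pow_le_cyclicDensity (c l b : ℕ) :
    (c + l + 1) * ∫⁻ p : α × α, (4 * pathDensity w p.1 p.2) ^ b ≤
      2 ^ cyclicEdges (c + l + 1) b (c + 1) * cyclicDensity w (c + l + 1) b (c + 1) + (c + l) := by
  refine (hw.mul_lintegral_pathDensity_pow_le hr c l b).trans ?_
  gcongr ?_ + _
  calc _ ≤ 2 ^ ((c + l + 1) * (c + 1) + (c + l + 1) * b + b * (c + 1)) *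
        (2 ^ ((c + l + 1).choose 2 + b.choose 2 + (c + 1).choose 2) *
          cyclicDensity w (c + l + 1) b (c + 1)) := by
        gcongr
        exact hw.blowupDensity_le_cyclicDensity _ _ _
    _ = _ := by
        rw [← mul_assoc, ← pow_add, cyclicEdges]
        congr 2
        ring

theorem one_le_lintegral_pathDensity_pow (n : ℕ) :
    1 ≤ ∫⁻ p : α × α, (4 * pathDensity w p.1 p.2) ^ (n + 1) :=
  one_le_lintegral_pow (hw.measurable_pathDensity.const_mul 4)
    (fun p => ENNReal.mul_ne_top (by simp)
      (ne_top_of_le_ne_top ENNReal.one_ne_top (hw.pathDensity_le_one _ _)))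
    (hw.lintegral_pathDensity hr) n

theorem one_le_cyclicDensity_of_le (c l b : ℕ) :
    1 ≤ 2 ^ cyclicEdges (c + l + 1) (b + 1) (c + 1) *
      cyclicDensity w (c + l + 1) (b + 1) (c + 1) := by
  have h := hw.lintegral_pathDensity_pow_le_cyclicDensity hr c l (b + 1)
  have h1 := hw.one_le_lintegral_pathDensity_pow hr b
  refine (ENNReal.add_le_add_iff_right (a := (c + l : ℝ≥0∞)) (by finiteness)).1 ?_
  calc (1 : ℝ≥0∞) + (c + l) = (c + l + 1) * 1 := by ring
    _ ≤ (c + l + 1) * ∫⁻ p : α × α, (4 * pathDensity w p.1 p.2) ^ (b + 1) := by gcongr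
    _ ≤ _ := h

theorem ae_eq_half_of_cyclicDensity_of_le (c l b : ℕ) (hle : 2 ^ cyclicEdges (c + l + 1) (b + 2) (c + 1) *
      cyclicDensity w (c + l + 1) (b + 2) (c + 1) ≤ 1) : ∀ᵐ p : α × α, w p.1 p.2 = 2⁻¹ := by
  have h := hw.lintegral_pathDensity_pow_le_cyclicDensity hr c l (b + 2)
  refine hw.ae_eq_half_of_pathDensity hr <|
    ae_eq_one_of_lintegral_pow_le (hw.measurable_pathDensity.const_mul 4)
    (fun p => ENNReal.mul_ne_top (by simp)
      (ne_top_of_le_ne_top ENNReal.one_ne_top (hw.pathDensity_le_one _ _)))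
    (hw.lintegral_pathDensity hr) b ?_
  refine (ENNReal.mul_le_mul_iff_right (a := (c + l + 1 : ℝ≥0∞)) (by simp) (by finiteness)).1 ?_
  calc _ ≤ _ := h
    _ ≤ 1 + (c + l) := by gcongr
    _ = (c + l + 1) * 1 := by ring

theorem one_le_cyclicDensity_zero (n : ℕ) :
    1 ≤ 2 ^ cyclicEdges (n + 1) 2 0 * cyclicDensity w (n + 1) 2 0 :=
  (one_le_lintegral_pow hw.measurable_codegree_left (hw.codegree_left_ne_top)
    (hw.lintegral_codegree_left hr) n).trans (hw.lintegral_codegree_pow_le_cyclicDensity (n + 1))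

theorem ae_eq_half_of_cyclicDensity_zero (n : ℕ)
    (hle : 2 ^ cyclicEdges (n + 2) 2 0 * cyclicDensity w (n + 2) 2 0 ≤ 1) :
    ∀ᵐ p : α × α, w p.1 p.2 = 2⁻¹ := by
  have h1 := ae_eq_one_of_lintegral_pow_le hw.measurable_codegree_left
    (hw.codegree_left_ne_top) (hw.lintegral_codegree_left hr) n
    ((hw.lintegral_codegree_pow_le_cyclicDensity (n + 2)).trans hle)
  refine hw.ae_eq_half_of_pathDensity hr ?_
  filter_upwards [h1, hw.ae_pathDensity_add_codegree hr] with p hp ⟨h2, _⟩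
  rw [hp] at h2
  exact (ENNReal.add_left_inj ENNReal.one_ne_top).1 (h2.trans one_add_one_eq_two.symm)

end Regular

end IsTournamentKernel

theorem cyclicEdges_rotate (a b c : ℕ) : cyclicEdges a b c = cyclicEdges b c a := by
  unfold cyclicEdges
  ring

/-- A rotation of the three parts makes the first at least as large as the third, and the second of
size at least two. -/
theorem rotation_induction {P : ℕ → ℕ → ℕ → Prop} (hrot : ∀ a b c, P a b c → P b c a)
    (h : ∀ c l b, P (c + l + 1) (b + 2) (c + 1)) {a b c : ℕ} (ha : 1 ≤ a) (hb : 1 ≤ b)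
    (hc : 1 ≤ c) (habc : 4 ≤ a + b + c) : P a b c := by
  have h' : ∀ a b c, c ≤ a → 2 ≤ b → 1 ≤ c → P a b c := by
    intro a b c h1 h2 h3
    have := h (c - 1) (a - c) (b - 2)
    rwa [show c - 1 + (a - c) + 1 = a by omega, show b - 2 + 2 = b by omega,
      show c - 1 + 1 = c by omega] at this
  rcases (by omega : (2 ≤ b ∧ c ≤ a) ∨ (2 ≤ a ∧ b ≤ c) ∨ (2 ≤ c ∧ a ≤ b)) with h1 | h1 | h1
  · exact h' a b c h1.2 h1.1 hc
  · exact hrot _ _ _ (h' c a b h1.2 h1.1 hb)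
  · exact hrot _ _ _ (hrot _ _ _ (h' b c a h1.2 h1.1 ha))

namespace IsTournamentKernel

variable {α : Type*} [MeasureSpace α] [IsProbabilityMeasure (volume : Measure α)]
  {w : α → α → ℝ≥0∞} (hw : IsTournamentKernel w) (hr : ∀ᵐ x : α, ∫⁻ y, w x y = 2⁻¹)

include hw hr

theorem one_le_cyclicDensity {a b c : ℕ} (ha : 1 ≤ a) (hb : 1 ≤ b) (hc : 1 ≤ c)
    (habc : 4 ≤ a + b + c) : 1 ≤ 2 ^ cyclicEdges a b c * cyclicDensity w a b c :=
  rotation_induction (P := fun a b c => 1 ≤ 2 ^ cyclicEdges a b c * cyclicDensity w a b c)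
    (fun a b c h => by rwa [← cyclicEdges_rotate, ← hw.cyclicDensity_rotate])
    (fun c l b => hw.one_le_cyclicDensity_of_le hr c l (b + 1)) ha hb hc habc

theorem ae_eq_half_of_cyclicDensity {a b c : ℕ} (ha : 1 ≤ a) (hb : 1 ≤ b) (hc : 1 ≤ c)
    (habc : 4 ≤ a + b + c) (hle : 2 ^ cyclicEdges a b c * cyclicDensity w a b c ≤ 1) :
    ∀ᵐ p : α × α, w p.1 p.2 = 2⁻¹ := by
  revert hle
  exact rotation_induction (P := fun a b c => 2 ^ cyclicEdges a b c * cyclicDensity w a b c ≤ 1 →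
      ∀ᵐ p : α × α, w p.1 p.2 = 2⁻¹)
    (fun a b c h => by rwa [← cyclicEdges_rotate, ← hw.cyclicDensity_rotate])
    (fun c l b => hw.ae_eq_half_of_cyclicDensity_of_le hr c l b) ha hb hc habc

theorem cyclicDensity_one_zero {a : ℕ} (ha : a ≤ 2) :
    2 ^ cyclicEdges a 1 0 * cyclicDensity w a 1 0 = 1 := by
  have h : blowupDensity w a 1 0 = 2⁻¹ ^ a := by
    simp only [blowupDensity, Finset.univ_unique, Finset.prod_singleton, Finset.univ_eq_empty,
      Finset.prod_empty, mul_one, one_mul, lintegral_const, measure_univ]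
    rw [show (default : Fin 1) = 0 from rfl, lintegral_fin_one fun y => (∫⁻ x, w x y) ^ a,
      lintegral_congr_ae (g := fun _ => 2⁻¹ ^ a)]
    · simp
    · filter_upwards [hw.ae_lintegral_left hr] with y hy
      rw [hy]
  have e : cyclicEdges a 1 0 = a + a.choose 2 := by simp [cyclicEdges, add_comm]
  rw [e, pow_add, mul_assoc, hw.two_pow_mul_cyclicDensity ha le_rfl zero_le_one, h, ← mul_pow,
    ENNReal.mul_inv_cancel (by simp) (by simp), one_pow]

theorem cyclicDensity_one_one : 2 ^ cyclicEdges 1 1 1 * cyclicDensity w 1 1 1 = 1 := by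
  have m : Measurable fun p : α × α => w p.2 p.1 * pathDensity w p.1 p.2 :=
    (hw.measurable_comp measurable_snd measurable_fst).mul hw.measurable_pathDensity
  have h : blowupDensity w 1 1 1 = ∫⁻ p : α × α, w p.2 p.1 * pathDensity w p.1 p.2 := by
    simp only [blowupDensity, Finset.univ_unique, Finset.prod_singleton, pow_one]
    rw [show (default : Fin 1) = 0 from rfl]
    rw [Measure.volume_eq_prod, lintegral_prod_symm _ m.aemeasurable,
      ← lintegral_fin_one fun z => ∫⁻ x, w z x * pathDensity w x z]
    refine lintegral_congr fun y => ?_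
    rw [← lintegral_fin_one fun x => w (y 0) x * pathDensity w x (y 0)]
    refine lintegral_congr fun z => ?_
    simp only [pathDensity]
    congr 1
    refine lintegral_congr fun x => ?_
    rw [mul_comm]
  have h1 := hw.lintegral_mul_pathDensity_pow hr 1
  have h2 := hw.lintegral_pathDensity hr
  simp only [pow_one] at h1
  rw [lintegral_const_mul _ hw.measurable_pathDensity] at h2
  have h3 := hw.two_pow_mul_cyclicDensity one_le_two (le_refl 1) (le_refl 1)
  rw [show Nat.choose 1 2 = 0 from rfl, pow_zero, one_mul] at h3
  rw [h3, h, show cyclicEdges 1 1 1 = 2 + 1 from rfl, pow_add, pow_one, mul_assoc, h1,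
    show (2 : ℝ≥0∞) ^ 2 = 4 by norm_num, h2]

end IsTournamentKernel

/-! ### From tournamentons to kernels -/

namespace Tournamenton

/-- A tournamenton as a function with values in `ℝ≥0∞`. -/
noncomputable def kernel (W : Tournamenton) (x y : unitInterval) : ℝ≥0∞ :=
  ENNReal.ofReal (W.toFun x y)

theorem nonneg (W : Tournamenton) (x y : unitInterval) : 0 ≤ W.toFun x y := (W.mem_Icc' x y).1

theorem isTournamentKernel_kernel (W : Tournamenton) : IsTournamentKernel W.kernel where
  measurable := W.measurable'.ennreal_ofReal
  add_swap x y := by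
    rw [kernel, kernel, ← ENNReal.ofReal_add (W.nonneg x y) (W.nonneg y x), W.add_swap',
      ENNReal.ofReal_one]

theorem ae_lintegral_kernel {W : Tournamenton} (hW : W.IsRegular) :
    ∀ᵐ x : unitInterval, ∫⁻ y, W.kernel x y = 2⁻¹ := by
  filter_upwards [hW] with x hx
  have hm : Measurable fun y => W.toFun x y := W.measurable'.comp measurable_prodMk_left
  have hint : Integrable (fun y => W.toFun x y) :=
    Integrable.of_bound hm.aestronglyMeasurable 1 (Filter.Eventually.of_forall fun y => by
      rw [Real.norm_of_nonneg (W.nonneg x y)]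
      exact (W.mem_Icc' x y).2)
  have := ofReal_integral_eq_lintegral_ofReal hint (Filter.Eventually.of_forall fun y => W.nonneg x y)
  simp only [kernel]
  rw [← this, hx, one_div, ENNReal.ofReal_inv_of_pos two_pos, ENNReal.ofReal_ofNat]

theorem aeEq_half_iff (W : Tournamenton) :
    W.AEEq half ↔ ∀ᵐ p : unitInterval × unitInterval, W.kernel p.1 p.2 = 2⁻¹ := by
  have key : ∀ p : unitInterval × unitInterval,
      W.toFun p.1 p.2 = half.toFun p.1 p.2 ↔ W.kernel p.1 p.2 = 2⁻¹ := by
    intro p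
    have h2 : (2 : ℝ≥0∞)⁻¹ = ENNReal.ofReal (1 / 2) := by
      rw [one_div, ENNReal.ofReal_inv_of_pos two_pos, ENNReal.ofReal_ofNat]
    rw [kernel, h2, ENNReal.ofReal_eq_ofReal_iff (W.nonneg _ _) (by norm_num)]
    rfl
  unfold AEEq
  simp_rw [key]

theorem kernel_half : half.kernel = fun _ _ => 2⁻¹ := by
  funext x y
  change ENNReal.ofReal (1 / 2) = 2⁻¹
  rw [one_div, ENNReal.ofReal_inv_of_pos two_pos, ENNReal.ofReal_ofNat]

theorem isRegular_half : half.IsRegular := Filter.Eventually.of_forall fun x => by simp [half]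

end Tournamenton

/-- The homomorphism density with values in `ℝ≥0∞`. -/
noncomputable def lhomDensity {V α : Type*} [Fintype V] [MeasureSpace α] (H : Digraph V)
    (w : α → α → ℝ≥0∞) : ℝ≥0∞ :=
  ∫⁻ x : V → α, ∏ e ∈ digraphEdges H, w (x e.1) (x e.2)

theorem homDensity_eq_toReal {V : Type*} [Fintype V] (H : Digraph V) (W : Tournamenton) :
    homDensity H W = (lhomDensity H W.kernel).toReal := by
  have hm : Measurable fun x : V → unitInterval =>
      ∏ e ∈ digraphEdges H, W.toFun (x e.1) (x e.2) :=
    Finset.measurable_fun_prod _ fun e _ => by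
      have h : Measurable fun x : V → unitInterval => (x e.1, x e.2) := by fun_prop
      exact W.measurable'.comp h
  rw [homDensity, integral_eq_lintegral_of_nonneg_ae
    (Filter.Eventually.of_forall fun x => Finset.prod_nonneg fun e _ => W.nonneg _ _)
    hm.aestronglyMeasurable, lhomDensity]
  congr 1
  refine lintegral_congr fun x => ?_
  rw [ENNReal.ofReal_prod_of_nonneg fun e _ => W.nonneg _ _]
  rfl

theorem lhomDensity_ne_top {V : Type*} [Fintype V] (H : Digraph V) (W : Tournamenton) :
    lhomDensity H W.kernel ≠ ∞ :=
  ne_top_of_le_ne_top ENNReal.one_ne_top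
    (lintegral_le_one fun _ => prod_le_one_of_le_one fun _ => W.isTournamentKernel_kernel.le_one _ _)

open Classical in
theorem prod_digraphEdges {V M : Type*} [Fintype V] [CommMonoid M] (H : Digraph V) (f : V → V → M) :
    ∏ e ∈ digraphEdges H, f e.1 e.2 = ∏ u, ∏ v, if H.Adj u v then f u v else 1 := by
  rw [digraphEdges, Finset.prod_filter, Fintype.prod_prod_type]

theorem lhomDensity_congr_iso {V V' α : Type*} [Fintype V] [Fintype V'] [MeasureSpace α]
    [SigmaFinite (volume : Measure α)] {G : Digraph V} {H : Digraph V'} (e : G.Adj ≃r H.Adj)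
    (w : α → α → ℝ≥0∞) : lhomDensity G w = lhomDensity H w := by
  classical
  rw [lhomDensity, lhomDensity, ← (volume_measurePreserving_piCongrLeft (fun _ : V' => α)
    e.toEquiv).lintegral_comp_emb (MeasurableEquiv.measurableEmbedding _)]
  refine lintegral_congr fun x => ?_
  have hx : ∀ v, MeasurableEquiv.piCongrLeft (fun _ : V' => α) e.toEquiv x (e.toEquiv v) = x v :=
      fun v => by
    rw [MeasurableEquiv.coe_piCongrLeft]
    exact Equiv.piCongrLeft_apply_apply (fun _ : V' => α) e.toEquiv x v
  rw [prod_digraphEdges G fun u v => w (x u) (x v), prod_digraphEdges H fun u v =>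
    w (MeasurableEquiv.piCongrLeft (fun _ : V' => α) e.toEquiv x u)
      (MeasurableEquiv.piCongrLeft (fun _ : V' => α) e.toEquiv x v),
    ← e.toEquiv.prod_comp]
  refine Finset.prod_congr rfl fun u _ => ?_
  rw [← e.toEquiv.prod_comp]
  refine Finset.prod_congr rfl fun v _ => ?_
  have he : H.Adj (e.toEquiv u) (e.toEquiv v) ↔ G.Adj u v := e.map_rel_iff
  rw [hx u, hx v]
  simp only [he]

theorem card_digraphEdges_congr_iso {V V' : Type*} [Fintype V] [Fintype V'] {G : Digraph V}
    {H : Digraph V'} (e : G.Adj ≃r H.Adj) : (digraphEdges G).card = (digraphEdges H).card := by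
  refine Finset.card_equiv (e.toEquiv.prodCongr e.toEquiv) fun p => ?_
  simp [digraphEdges, e.map_rel_iff]

theorem lhomDensity_half {V : Type*} [Fintype V] (H : Digraph V) :
    lhomDensity H (fun _ _ : unitInterval => 2⁻¹) = 2⁻¹ ^ (digraphEdges H).card := by
  simp [lhomDensity]

theorem lhomDensity_cyclicTournament {α : Type*} [MeasureSpace α]
    [IsProbabilityMeasure (volume : Measure α)] {w : α → α → ℝ≥0∞} (hw : IsTournamentKernel w)
    (a b c : ℕ) : lhomDensity (cyclicTournament a b c) w = cyclicDensity w a b c := by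
  classical
  have m : ∀ n, Measurable (chainWeight w : (Fin n → α) → ℝ≥0∞) :=
    fun n => hw.measurable_chainWeight measurable_id
  let F : (Fin a → α) × (Fin b → α) × (Fin c → α) → ℝ≥0∞ := fun p =>
    chainWeight w p.1 * chainWeight w p.2.1 * chainWeight w p.2.2 *
      (crossWeight w p.1 p.2.1 * crossWeight w p.2.1 p.2.2 * crossWeight w p.2.2 p.1)
  have mF : Measurable F := by
    have m1 : Measurable fun p : (Fin a → α) × (Fin b → α) × (Fin c → α) =>
        crossWeight w p.1 p.2.1 := hw.measurable_crossWeight (by fun_prop) (by fun_prop)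
    have m2 : Measurable fun p : (Fin a → α) × (Fin b → α) × (Fin c → α) =>
        crossWeight w p.2.1 p.2.2 := hw.measurable_crossWeight (by fun_prop) (by fun_prop)
    have m3 : Measurable fun p : (Fin a → α) × (Fin b → α) × (Fin c → α) =>
        crossWeight w p.2.2 p.1 := hw.measurable_crossWeight (by fun_prop) (by fun_prop)
    exact ((((m a).comp measurable_fst).mul ((m b).comp (measurable_fst.comp measurable_snd))).mul
      ((m c).comp (measurable_snd.comp measurable_snd))).mul ((m1.mul m2).mul m3)
  have e1 : cyclicDensity w a b c = ∫⁻ p, F p := by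
    rw [Measure.volume_eq_prod, lintegral_prod _ mF.aemeasurable]
    refine lintegral_congr fun x => ?_
    have mx : Measurable fun q => F (x, q) := mF.comp measurable_prodMk_left
    rw [Measure.volume_eq_prod, lintegral_prod _ mx.aemeasurable]
  have mp : MeasurePreserving fun f : Fin a ⊕ Fin b ⊕ Fin c → α =>
      ((fun i => f (.inl i), (fun i => f (.inr (.inl i)), fun i => f (.inr (.inr i)))) :
        (Fin a → α) × (Fin b → α) × (Fin c → α)) := by
    have h1 := volume_measurePreserving_sumPiEquivProdPi (fun _ : Fin a ⊕ Fin b ⊕ Fin c => α)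
    have h2 := volume_measurePreserving_sumPiEquivProdPi (fun _ : Fin b ⊕ Fin c => α)
    exact ((MeasurePreserving.id (volume : Measure (Fin a → α))).prod h2).comp h1
  rw [e1, ← mp.lintegral_comp mF]
  refine lintegral_congr fun f => ?_
  rw [prod_digraphEdges (cyclicTournament a b c) fun u v => w (f u) (f v)]
  simp only [Fintype.prod_sum_type, cyclicTournament, cyclicBlowup, transitiveParts, F,
    chainWeight, crossWeight]
  simp only [false_or, or_false, if_true, if_false, or_self,
    Finset.prod_const_one, one_mul, mul_one, Finset.prod_mul_distrib]
  ring

theorem card_digraphEdges_cyclicTournament (a b c : ℕ) :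
    (digraphEdges (cyclicTournament a b c)).card = cyclicEdges a b c := by
  have h1 := lhomDensity_half (cyclicTournament a b c)
  have hk := Tournamenton.half.isTournamentKernel_kernel
  rw [Tournamenton.kernel_half] at hk
  rw [lhomDensity_cyclicTournament hk, cyclicDensity_half, ← ENNReal.inv_pow, ← ENNReal.inv_pow,
    inv_inj] at h1
  have h2 : (2 : ℕ) ^ cyclicEdges a b c = 2 ^ (digraphEdges (cyclicTournament a b c)).card := by
    exact_mod_cast h1
  exact (Nat.pow_right_injective le_rfl h2).symm

/-- Evaluation at two distinct coordinates is measure preserving. -/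
theorem measurePreserving_eval_pair {V α : Type*} [Fintype V] [MeasureSpace α]
    [IsProbabilityMeasure (volume : Measure α)] {u v : V} (huv : u ≠ v) :
    MeasurePreserving fun x : V → α => (x u, x v) := by
  have h := (ProbabilityTheory.iIndepFun_pi (μ := fun _ : V => (volume : Measure α))
    (X := fun _ x => x) fun _ => aemeasurable_id').indepFun huv
  have mu : ∀ v : V, Measurable fun x : V → α => x v := fun v => measurable_pi_apply v
  rw [ProbabilityTheory.indepFun_iff_map_prod_eq_prod_map_map (mu u).aemeasurable
    (mu v).aemeasurable, (measurePreserving_eval (fun _ : V => (volume : Measure α)) u).map_eq,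
    (measurePreserving_eval (fun _ : V => (volume : Measure α)) v).map_eq] at h
  exact ⟨by fun_prop, h⟩

theorem IsTournament.ne_of_mem_digraphEdges {V : Type*} [Fintype V] {T : Digraph V}
    (hT : IsTournament T) {e : V × V} (he : e ∈ digraphEdges T) : e.1 ≠ e.2 := by
  intro h
  simp only [digraphEdges, Finset.mem_filter, Finset.mem_univ, true_and] at he
  exact hT.loopless _ (h ▸ he)

theorem lhomDensity_of_ae_eq_half {V : Type*} [Fintype V] {T : Digraph V} (hT : IsTournament T)
    {w : unitInterval → unitInterval → ℝ≥0∞}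
    (hw : ∀ᵐ p : unitInterval × unitInterval, w p.1 p.2 = 2⁻¹) :
    lhomDensity T w = 2⁻¹ ^ (digraphEdges T).card := by
  rw [← lhomDensity_half]
  refine lintegral_congr_ae ?_
  have h : ∀ᵐ x : V → unitInterval, ∀ e ∈ digraphEdges T, w (x e.1) (x e.2) = 2⁻¹ := by
    rw [ae_all_iff]
    intro e
    by_cases he : e ∈ digraphEdges T
    · have := (measurePreserving_eval_pair (α := unitInterval)
        (hT.ne_of_mem_digraphEdges he)).quasiMeasurePreserving.ae hw
      filter_upwards [this] with x hx _
      exact hx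
    · exact Filter.Eventually.of_forall fun x h => absurd h he
  filter_upwards [h] with x hx
  exact Finset.prod_congr rfl hx

/-- The density bound in regular tournamentons, together with its equality case, in the form in
which it is proved for kernels. -/
def HalfMinimizes {V : Type*} [Fintype V] (T : Digraph V) : Prop :=
  ∀ W : Tournamenton, W.IsRegular →
    1 ≤ 2 ^ (digraphEdges T).card * lhomDensity T W.kernel ∧
      (2 ^ (digraphEdges T).card * lhomDensity T W.kernel ≤ 1 → W.AEEq Tournamenton.half)

theorem HalfMinimizes.of_iso {V V' : Type*} [Fintype V] [Fintype V'] {G : Digraph V}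
    {H : Digraph V'} (e : DigraphIso G H) (hH : HalfMinimizes H) : HalfMinimizes G := by
  obtain ⟨e⟩ := e
  intro W hW
  rw [lhomDensity_congr_iso e, card_digraphEdges_congr_iso e]
  exact hH W hW

theorem halfMinimizes_cyclicTournament {a b c : ℕ} (ha : 1 ≤ a) (hb : 1 ≤ b) (hc : 1 ≤ c)
    (habc : 4 ≤ a + b + c) : HalfMinimizes (cyclicTournament a b c) := by
  intro W hW
  have hw := W.isTournamentKernel_kernel
  have hr := Tournamenton.ae_lintegral_kernel hW
  rw [card_digraphEdges_cyclicTournament, lhomDensity_cyclicTournament hw, W.aeEq_half_iff]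
  exact ⟨hw.one_le_cyclicDensity hr ha hb hc habc, hw.ae_eq_half_of_cyclicDensity hr ha hb hc habc⟩

theorem halfMinimizes_cyclicTournament_zero (n : ℕ) :
    HalfMinimizes (cyclicTournament (n + 2) 2 0) := by
  intro W hW
  have hw := W.isTournamentKernel_kernel
  have hr := Tournamenton.ae_lintegral_kernel hW
  rw [card_digraphEdges_cyclicTournament, lhomDensity_cyclicTournament hw, W.aeEq_half_iff]
  exact ⟨hw.one_le_cyclicDensity_zero hr (n + 1), hw.ae_eq_half_of_cyclicDensity_zero hr n⟩

theorem homDensity_half {V : Type*} [Fintype V] (H : Digraph V) :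
    homDensity H Tournamenton.half = (1 / 2 : ℝ) ^ (digraphEdges H).card := by
  rw [homDensity_eq_toReal, Tournamenton.kernel_half, lhomDensity_half]
  simp

theorem homDensity_eq_half_pow_iff {V : Type*} [Fintype V] (H : Digraph V) (W : Tournamenton) :
    homDensity H W = (1 / 2 : ℝ) ^ (digraphEdges H).card ↔
      2 ^ (digraphEdges H).card * lhomDensity H W.kernel = 1 := by
  have h2 : (1 / 2 : ℝ) ^ (digraphEdges H).card = ((2⁻¹ : ℝ≥0∞) ^ (digraphEdges H).card).toReal := by
    simp
  rw [homDensity_eq_toReal, h2, ENNReal.toReal_eq_toReal_iff' (lhomDensity_ne_top H W)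
    (by finiteness), ← ENNReal.mul_right_inj (a := 2 ^ (digraphEdges H).card) (by simp)
    (by finiteness), ← mul_pow, ENNReal.mul_inv_cancel (by simp) (by simp), one_pow]

theorem HalfMinimizes.isUniqueRegularMinimizer {V : Type*} [Fintype V] {T : Digraph V}
    (h : HalfMinimizes T) : IsUniqueRegularMinimizer T Tournamenton.half := by
  refine ⟨Tournamenton.isRegular_half, fun W hW => ?_, fun W hW hWT => ?_⟩
  · rw [homDensity_eq_toReal, homDensity_eq_toReal, Tournamenton.kernel_half, lhomDensity_half]
    refine ENNReal.toReal_mono (lhomDensity_ne_top T W) ?_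
    refine (ENNReal.mul_le_mul_iff_right (a := 2 ^ (digraphEdges T).card) (by simp)
      (by finiteness)).1 ?_
    rw [← mul_pow, ENNReal.mul_inv_cancel (by simp) (by simp), one_pow]
    exact (h W hW).1
  · rw [homDensity_half, homDensity_eq_half_pow_iff] at hWT
    exact (h W hW).2 hWT.le

theorem HalfMinimizes.quasirandomForcingInRegular {V : Type*} [Fintype V] {T : Digraph V}
    (hT : IsTournament T) (h : HalfMinimizes T) : QuasirandomForcingInRegular T := by
  refine fun W hW => ⟨fun hWT => ?_, fun hWT => ?_⟩
  · exact (h W hW).2 ((homDensity_eq_half_pow_iff T W).1 hWT).le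
  · rw [homDensity_eq_half_pow_iff, lhomDensity_of_ae_eq_half hT (W.aeEq_half_iff.1 hWT), ← mul_pow,
      ENNReal.mul_inv_cancel (by simp) (by simp), one_pow]

/-! ### Regular tournamentons that avoid many tournaments -/

section Group

variable {G : Type*} [AddCommGroup G] [MeasurableSpace G]

/-- The function of the difference of two group elements that defines a tournamenton: `1` if the
difference lies in `P`, `0` if its negative does, and `1 / 2` if neither or both do. -/
noncomputable def orientation {G : Type*} [AddCommGroup G] (P : Set G) (d : G) : ℝ :=
  (1 + P.indicator 1 d - P.indicator 1 (-d)) / 2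

theorem orientation_add_neg {G : Type*} [AddCommGroup G] (P : Set G) (d : G) :
    orientation P d + orientation P (-d) = 1 := by
  simp only [orientation, neg_neg]
  ring

theorem orientation_mem_Icc {G : Type*} [AddCommGroup G] (P : Set G) (d : G) :
    orientation P d ∈ Set.Icc (0 : ℝ) 1 := by
  have h : ∀ d : G, P.indicator (1 : G → ℝ) d ∈ Set.Icc (0 : ℝ) 1 := fun d => by
    by_cases hd : d ∈ P <;> simp [hd]
  have h1 := h d
  have h2 := h (-d)
  rw [Set.mem_Icc] at *
  unfold orientation
  constructor <;> linarith

theorem measurable_orientation [MeasurableNeg G] {P : Set G} (hP : MeasurableSet P) :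
    Measurable (orientation P) := by
  have h : Measurable (P.indicator (1 : G → ℝ)) := measurable_const.indicator hP
  exact ((measurable_const.add h).sub (h.comp measurable_neg)).div_const 2

/-- An invariant probability measure on an infinite group has no atoms. -/
theorem nullSingletonClass_of_infinite [Infinite G] [MeasurableSingletonClass G] [MeasurableAdd G]
    (μ : Measure G) [IsProbabilityMeasure μ] [μ.IsAddRightInvariant] : NullSingletonClass μ := by
  have h0 : ∀ x : G, μ {x} = μ {0} := fun x => by
    rw [← measure_preimage_add_right μ x {x}]
    congr 1
    ext y
    simp
  refine ⟨fun x => ?_⟩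
  by_contra hx
  have h1 : μ (⋃ n, {Infinite.natEmbedding G n}) = ∞ := by
    rw [measure_iUnion]
    · simp_rw [h0 (Infinite.natEmbedding G _), ← h0 x]
      exact ENNReal.tsum_const_eq_top_of_ne_zero hx
    · intro i j hij
      simpa using fun h => hij ((Infinite.natEmbedding G).injective h)
    · exact fun i => measurableSet_singleton _
  exact measure_ne_top μ _ h1

/-- If `P` and `-P` partition a compact group up to a null set, orienting pairs by whether their
difference lies in `P` defines a regular tournamenton, and a tournament with positive density in it
is realised by points of the group. -/
theorem exists_tournamenton_of_group [StandardBorelSpace G] [MeasurableAdd₂ G] [MeasurableNeg G]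
    (μ : Measure G) [IsProbabilityMeasure μ] [μ.IsAddRightInvariant] [μ.IsNegInvariant]
    {P : Set G} (hP : MeasurableSet P) (hdisj : ∀ d ∈ P, -d ∉ P)
    (hnull : μ {d | d ∉ P ∧ -d ∉ P} = 0) :
    ∃ W : Tournamenton, W.IsRegular ∧ ¬ W.AEEq Tournamenton.half ∧
      ∀ {V : Type*} [Fintype V] (T : Digraph V), IsTournament T → homDensity T W ≠ 0 →
        ∃ φ : V → G, ∀ u v, T.Adj u v → φ v - φ u ∈ P := by
  obtain ⟨π, hπ, hμ⟩ := μ.exists_measurable_map_eq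
  have mpπ : MeasurePreserving π volume μ := ⟨hπ, hμ⟩
  have mh := measurable_orientation hP
  let W : Tournamenton :=
    { toFun := fun x y => orientation P (π y - π x)
      measurable' := mh.comp ((hπ.comp measurable_snd).sub (hπ.comp measurable_fst))
      mem_Icc' := fun x y => orientation_mem_Icc P _
      add_swap' := fun x y => by
        rw [← neg_sub (π y) (π x)]
        exact orientation_add_neg P _ }
  have hreg : W.IsRegular := by
    have hint : Integrable (orientation P) μ :=
      Integrable.of_bound mh.aestronglyMeasurable 1 (Filter.Eventually.of_forall fun d => by
        rw [Real.norm_of_nonneg (orientation_mem_Icc P d).1]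
        exact (orientation_mem_Icc P d).2)
    have hhalf : ∫ d, orientation P d ∂μ = 1 / 2 := by
      have h1 : ∫ d, orientation P (-d) ∂μ = ∫ d, orientation P d ∂μ :=
        integral_neg_eq_self (orientation P) μ
      have h2 : ∫ d, (orientation P d + orientation P (-d)) ∂μ = 1 := by
        simp [orientation_add_neg]
      have hint' : Integrable (fun d => orientation P (-d)) μ :=
        (Measure.measurePreserving_neg μ).integrable_comp_of_integrable hint
      rw [integral_add hint hint', h1] at h2
      linarith
    refine Filter.Eventually.of_forall fun x => ?_
    have h3 : ∫ y, orientation P (π y - π x) = ∫ g, orientation P (g - π x) ∂μ := by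
      have ms : Measurable fun g => orientation P (g - π x) :=
        mh.comp (measurable_id.sub measurable_const)
      rw [← hμ, integral_map hπ.aemeasurable ms.aestronglyMeasurable]
    change ∫ y, orientation P (π y - π x) = 1 / 2
    rw [h3, integral_sub_right_eq_self (orientation P) (π x), hhalf]
  have hN : ∀ᵐ p : unitInterval × unitInterval, π p.2 - π p.1 ∈ P ∨ -(π p.2 - π p.1) ∈ P := by
    have m1 : Measurable fun p : unitInterval × unitInterval => π p.2 - π p.1 :=
      (hπ.comp measurable_snd).sub (hπ.comp measurable_fst)
    have mS : MeasurableSet {p : unitInterval × unitInterval |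
        π p.2 - π p.1 ∈ P ∨ -(π p.2 - π p.1) ∈ P} :=
      (m1 hP).union (m1.neg hP)
    rw [Measure.volume_eq_prod]
    refine (Measure.ae_prod_mem_iff_ae_ae_mem mS).2 (Filter.Eventually.of_forall fun x => ?_)
    have h1 : ∀ᵐ d ∂μ, d ∈ P ∨ -d ∈ P := by
      rw [ae_iff]
      simpa only [not_or] using hnull
    have h2 := ((measurePreserving_sub_right μ (π x)).comp mpπ).quasiMeasurePreserving.ae h1
    exact h2
  refine ⟨W, hreg, fun hW => ?_, fun {V} _ T hT hpos => ?_⟩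
  · obtain ⟨p, hp1, hp2⟩ := (hW.and hN).exists
    have hp : orientation P (π p.2 - π p.1) = 1 / 2 := hp1
    unfold orientation at hp
    rcases hp2 with h | h
    · rw [Set.indicator_of_mem h, Set.indicator_of_notMem (hdisj _ h)] at hp
      norm_num at hp
    · have h' : π p.2 - π p.1 ∉ P := fun h'' => hdisj _ h'' h
      rw [Set.indicator_of_mem h, Set.indicator_of_notMem h'] at hp
      norm_num at hp
  · have h : ∀ᵐ x : V → unitInterval, ∀ e ∈ digraphEdges T,
        π (x e.2) - π (x e.1) ∈ P ∨ -(π (x e.2) - π (x e.1)) ∈ P := by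
      rw [ae_all_iff]
      intro e
      by_cases he : e ∈ digraphEdges T
      · filter_upwards [(measurePreserving_eval_pair (α := unitInterval)
          (hT.ne_of_mem_digraphEdges he)).quasiMeasurePreserving.ae hN] with x hx _
        exact hx
      · exact Filter.Eventually.of_forall fun x h => absurd h he
    by_contra! hcon
    refine hpos ?_
    rw [homDensity, integral_congr_ae (g := fun _ => 0)]
    · simp
    filter_upwards [h] with x hx
    obtain ⟨u, v, huv, hPuv⟩ := hcon fun v => π (x v)
    have he : (u, v) ∈ digraphEdges T := by simp [digraphEdges, huv]
    refine Finset.prod_eq_zero he ?_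
    have h1 := (hx _ he).resolve_left hPuv
    change orientation P (π (x v) - π (x u)) = 0
    rw [orientation, Set.indicator_of_notMem hPuv, Set.indicator_of_mem h1]
    norm_num

end Group

/-! ### The carousel -/

/-- A tournament is locally transitive if all out- and inneighbourhoods are transitive. -/
structure IsLocallyTransitive {V : Type*} (T : Digraph V) : Prop where
  out : ∀ u v w x, T.Adj u v → T.Adj u w → T.Adj u x → T.Adj v w → T.Adj w x → T.Adj v x
  into : ∀ u v w x, T.Adj v u → T.Adj w u → T.Adj x u → T.Adj v w → T.Adj w x → T.Adj v x

theorem im_toCircle_sub (x y : UnitAddCircle) :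
    ((AddCircle.toCircle (y - x) : Circle) : ℂ).im =
      (AddCircle.toCircle x : ℂ).re * (AddCircle.toCircle y : ℂ).im -
        (AddCircle.toCircle x : ℂ).im * (AddCircle.toCircle y : ℂ).re := by
  rw [sub_eq_add_neg, AddCircle.toCircle_add, AddCircle.toCircle_neg, Circle.coe_mul,
    Circle.coe_inv_eq_conj, Complex.mul_im, Complex.conj_re, Complex.conj_im]
  ring

/-- Points of a circle, each pair oriented along the shorter arc, give a regular tournamenton in
which only locally transitive tournaments have positive density. -/
theorem exists_carousel : ∃ W : Tournamenton, W.IsRegular ∧ ¬ W.AEEq Tournamenton.half ∧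
    ∀ {V : Type*} [Fintype V] (T : Digraph V), IsTournament T → homDensity T W ≠ 0 →
      IsLocallyTransitive T := by
  have : Infinite UnitAddCircle := by
    have : Infinite (Set.Ico (0 : ℝ) (0 + 1)) := (Set.Ico_infinite (by norm_num)).to_subtype
    exact Infinite.of_injective _ (AddCircle.equivIco (1 : ℝ) 0).symm.injective
  have : NullSingletonClass (AddCircle.haarAddCircle : Measure UnitAddCircle) :=
    nullSingletonClass_of_infinite _
  have mim : Measurable fun d : UnitAddCircle => ((AddCircle.toCircle d : Circle) : ℂ).im :=
    (Complex.continuous_im.comp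
      (continuous_subtype_val.comp AddCircle.continuous_toCircle)).measurable
  have hneg : ∀ d : UnitAddCircle, ((AddCircle.toCircle (-d) : Circle) : ℂ).im =
      -((AddCircle.toCircle d : Circle) : ℂ).im := fun d => by
    rw [AddCircle.toCircle_neg, Circle.coe_inv_eq_conj, Complex.conj_im]
  obtain ⟨W, hreg, hne, hW⟩ := exists_tournamenton_of_group
    (AddCircle.haarAddCircle : Measure UnitAddCircle)
    (P := {d | 0 < ((AddCircle.toCircle d : Circle) : ℂ).im})
    (measurableSet_lt measurable_const mim)
    (fun d hd => by
      simp only [Set.mem_ofPred_eq, hneg] at hd ⊢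
      linarith)
    (by
      refine Set.Finite.measure_zero ?_ _
      refine Set.Finite.subset (((Set.toFinite {(1 : ℂ), -1}).preimage
        ((Subtype.val_injective.comp (AddCircle.injective_toCircle one_ne_zero)).injOn))) ?_
      intro d hd
      simp only [Set.mem_ofPred_eq, hneg] at hd
      have him : ((AddCircle.toCircle d : Circle) : ℂ).im = 0 := by linarith [hd.1, hd.2]
      have hnorm : ((AddCircle.toCircle d : Circle) : ℂ).re *
          ((AddCircle.toCircle d : Circle) : ℂ).re = 1 := by
        have h1 := Circle.normSq_coe (AddCircle.toCircle d)
        rw [Complex.normSq_apply, him] at h1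
        linarith
      rcases mul_self_eq_one_iff.1 hnorm with h | h
      · exact Or.inl (Complex.ext h him)
      · refine Or.inr (Complex.ext ?_ ?_)
        · rw [Complex.neg_re, Complex.one_re]
          exact h
        · rw [Complex.neg_im, Complex.one_im, neg_zero]
          exact him)
  refine ⟨W, hreg, hne, fun {V} _ T hT hpos => ?_⟩
  obtain ⟨φ, hφ⟩ := hW T hT hpos
  -- `D v x` is the sine of the angle from `v` to `x`; its Plücker relations give the claim.
  set D : V → V → ℝ := fun v x =>
    (AddCircle.toCircle (φ v) : ℂ).re * (AddCircle.toCircle (φ x) : ℂ).im -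
      (AddCircle.toCircle (φ v) : ℂ).im * (AddCircle.toCircle (φ x) : ℂ).re with hD
  have hadj : ∀ u v, T.Adj u v → 0 < D u v := fun u v h => by
    have h1 : 0 < ((AddCircle.toCircle (φ v - φ u) : Circle) : ℂ).im := hφ u v h
    rwa [im_toCircle_sub] at h1
  have key : ∀ v x, 0 < D v x → T.Adj v x := by
    intro v x h
    have hvx : v ≠ x := by
      rintro rfl
      simp only [hD] at h
      linarith
    rcases hT.oriented v x hvx with ⟨h', _⟩ | ⟨h', _⟩
    · exact h'
    · have h1 := hadj _ _ h'
      simp only [hD] at h h1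
      linarith
  constructor
  · intro u v w x uv uw ux vw wx
    refine key v x (pos_of_mul_pos_left (b := D u w) ?_ (hadj _ _ uw).le)
    have h1 := mul_pos (hadj _ _ uv) (hadj _ _ wx)
    have h2 := mul_pos (hadj _ _ ux) (hadj _ _ vw)
    have h3 : D v x * D u w = D u v * D w x + D u x * D v w := by
      simp only [hD]
      ring
    linarith
  · intro u v w x vu wu xu vw wx
    refine key v x (pos_of_mul_pos_left (b := D w u) ?_ (hadj _ _ wu).le)
    have h1 := mul_pos (hadj _ _ vw) (hadj _ _ xu)
    have h2 := mul_pos (hadj _ _ wx) (hadj _ _ vu)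
    have h3 : D v x * D w u = D v w * D x u + D w x * D v u := by
      simp only [hD]
      ring
    linarith

/-! ### The iterated cyclic triangle -/

/-- Sequences over `ZMod 3`, each pair oriented cyclically according to the first place at which
the two differ, give a regular tournamenton in which only iterated blow-ups of the cyclic triangle
have positive density; only the outermost level of the blow-up is recorded here. -/
theorem exists_ternary : ∃ W : Tournamenton, W.IsRegular ∧
    ∀ {V : Type*} [Fintype V] [Nontrivial V] (T : Digraph V), IsTournament T →
      homDensity T W ≠ 0 →
        ∃ p : V → ZMod 3, (∃ u v, p u ≠ p v) ∧
          ∀ u v, T.Adj u v → p u ≠ p v → p v = p u + 1 := by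
  set μ : Measure (ℕ → ZMod 3) := Measure.addHaarMeasure ⊤ with hμ
  have hprob : IsProbabilityMeasure μ :=
    ⟨by simpa using Measure.addHaarMeasure_self (K₀ := (⊤ : TopologicalSpace.PositiveCompacts
      (ℕ → ZMod 3)))⟩
  have : NullSingletonClass μ := nullSingletonClass_of_infinite _
  set P : Set (ℕ → ZMod 3) := {d | ∃ n, (∀ m < n, d m = 0) ∧ d n = 1} with hP
  have hPm : MeasurableSet P := by
    have h1 : P = ⋃ n, (⋂ m, ⋂ (_ : m < n), {d | d m = 0}) ∩ {d | d n = 1} := by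
      ext d
      simp [hP]
    have h2 : ∀ (n : ℕ) (c : ZMod 3), MeasurableSet {d : ℕ → ZMod 3 | d n = c} := fun n c =>
      measurableSet_eq_fun (measurable_pi_apply n) measurable_const
    rw [h1]
    exact MeasurableSet.iUnion fun n => (MeasurableSet.iInter fun m => MeasurableSet.iInter fun _ =>
      h2 m 0).inter (h2 n 1)
  -- The first nonzero digit of an element of `P` is `1`.
  have hfirst : ∀ d ∈ P, ∀ n, (∀ m < n, d m = 0) → d n ≠ 0 → d n = 1 := by
    rintro d ⟨k, hk, hk1⟩ n hn hn0
    rcases lt_trichotomy k n with h | h | h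
    · rw [hn k h] at hk1
      exact absurd hk1 (by decide)
    · exact h ▸ hk1
    · exact absurd (hk n h) hn0
  obtain ⟨W, hreg, -, hW⟩ := exists_tournamenton_of_group μ hPm
    (fun d hd hd' => by
      obtain ⟨n, hn, hn1⟩ := hd
      have h1 := hfirst _ hd' n (fun m hm => by simp [hn m hm]) (by simp [hn1])
      rw [Pi.neg_apply, hn1] at h1
      exact (by decide : (-1 : ZMod 3) ≠ 1) h1)
    (by
      refine measure_mono_null (t := {0}) (fun d hd => ?_) (measure_singleton 0)
      by_contra hd0
      have hex : ∃ n, d n ≠ 0 := by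
        by_contra! h
        exact hd0 (funext h)
      classical
      have hmin : ∀ m < Nat.find hex, d m = 0 := fun m hm => not_not.1 (Nat.find_min hex hm)
      have h3 : ∀ x : ZMod 3, x ≠ 0 → x = 1 ∨ -x = 1 := by decide
      rcases h3 _ (Nat.find_spec hex) with h | h
      · exact hd.1 ⟨_, hmin, h⟩
      · exact hd.2 ⟨_, fun m hm => by simp [hmin m hm], h⟩)
  refine ⟨W, hreg, fun {V} _ _ T hT hpos => ?_⟩
  obtain ⟨φ, hφ⟩ := hW T hT hpos
  have hex : ∃ n, ∃ u v, φ u n ≠ φ v n := by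
    obtain ⟨u, v, huv⟩ := exists_pair_ne V
    by_contra! h
    have h0 : ∀ u v, φ v - φ u = 0 := fun u v => by
      funext n
      simp [h n u v]
    have h0P : (0 : ℕ → ZMod 3) ∉ P := by
      rintro ⟨n, _, hn⟩
      exact (by decide : (0 : ZMod 3) ≠ 1) hn
    rcases hT.oriented u v huv with ⟨h', _⟩ | ⟨h', _⟩
    · exact h0P (h0 u v ▸ hφ _ _ h')
    · exact h0P (h0 v u ▸ hφ _ _ h')
  classical
  refine ⟨fun v => φ v (Nat.find hex), Nat.find_spec hex, fun u v huv hne => ?_⟩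
  have h1 := hfirst _ (hφ u v huv) (Nat.find hex) (fun m hm => ?_) ?_
  · rw [Pi.sub_apply] at h1
    rw [← h1]
    ring
  · have h2 := Nat.find_min hex hm
    push Not at h2
    rw [Pi.sub_apply, h2 u v, sub_self]
  · rw [Pi.sub_apply]
    exact sub_ne_zero.2 (Ne.symm hne)

/-! ### The structure of tournaments with positive density -/

theorem isTournament_cyclicTournament (a b c : ℕ) : IsTournament (cyclicTournament a b c) where
  loopless := by
    rintro (i | i | i) <;> simp [cyclicTournament, cyclicBlowup, transitiveParts]
  oriented := by
    rintro (i | i | i) (j | j | j) h <;>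
      simp only [cyclicTournament, cyclicBlowup, transitiveParts, false_or, Xor,
        not_true_eq_false, not_false_eq_true, and_true, and_false, or_false, ne_eq, Sum.inl.injEq,
        Sum.inr.injEq, not_lt] at h ⊢
    all_goals omega

theorem not_isTransitiveDigraph_cyclicTournament {a b c : ℕ} (ha : 1 ≤ a) (hb : 1 ≤ b)
    (hc : 1 ≤ c) : ¬ IsTransitiveDigraph (cyclicTournament a b c) := by
  intro h
  have := h (.inl ⟨0, ha⟩) (.inr (.inl ⟨0, hb⟩)) (.inr (.inr ⟨0, hc⟩))
  simp [cyclicTournament, cyclicBlowup, transitiveParts] at this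

theorem isTransitiveDigraph_cyclicTournament_zero (a b : ℕ) :
    IsTransitiveDigraph (cyclicTournament a b 0) := by
  rintro (i | i | i) (j | j | j) (k | k | k) <;>
    first
    | exact i.elim0
    | exact j.elim0
    | exact k.elim0
    | (simp only [cyclicTournament, cyclicBlowup, transitiveParts, false_or, or_false,
        true_implies, implies_true, false_implies]
       try exact lt_trans)

theorem IsTransitiveDigraph.of_iso {V V' : Type*} {G : Digraph V} {H : Digraph V'}
    (e : DigraphIso G H) (hH : IsTransitiveDigraph H) : IsTransitiveDigraph G := by
  obtain ⟨e⟩ := e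
  intro u v w huv hvw
  rw [← e.map_rel_iff] at *
  exact hH _ _ _ huv hvw

theorem DigraphIso.symm {V V' : Type*} {G : Digraph V} {H : Digraph V'} (e : DigraphIso G H) :
    DigraphIso H G :=
  e.map RelIso.symm

/-- A finite transitive tournament is a finite linear order. -/
theorem IsTournament.nonempty_relIso_fin {V : Type*} [Fintype V] {T : Digraph V}
    (hT : IsTournament T) (htr : IsTransitiveDigraph T) :
    Nonempty (T.Adj ≃r ((· < ·) : Fin (Fintype.card V) → Fin (Fintype.card V) → Prop)) := by
  classical
  have hsto : IsStrictTotalOrder V T.Adj :=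
    { trichotomous := fun u v h1 h2 => by
        by_contra huv
        rcases hT.oriented u v huv with ⟨h, _⟩ | ⟨h, _⟩
        · exact h1 h
        · exact h2 h
      irrefl := hT.loopless
      trans := htr }
  let _ : LinearOrder V := linearOrderOfSTO T.Adj
  exact ⟨(Fintype.orderIsoFinOfCardEq V rfl).symm.toRelIsoLT⟩

theorem IsTournament.digraphIso_of_isTransitiveDigraph {V V' : Type*} [Fintype V] [Fintype V']
    {G : Digraph V} {H : Digraph V'} (hG : IsTournament G) (hH : IsTournament H)
    (hGt : IsTransitiveDigraph G) (hHt : IsTransitiveDigraph H)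
    (hc : Fintype.card V = Fintype.card V') : DigraphIso G H := by
  obtain ⟨e⟩ := hG.nonempty_relIso_fin hGt
  obtain ⟨f⟩ := hH.nonempty_relIso_fin hHt
  rw [← hc] at f
  exact ⟨e.trans f.symm⟩

/-- A tournament whose vertices fall into three transitive classes, with all edges between
different classes directed cyclically, is some `T[a,b,c]`. -/
theorem IsTournament.digraphIso_cyclicTournament_of_classes {V : Type*} [Fintype V]
    {T : Digraph V} (hT : IsTournament T) (p : V → ZMod 3)
    (hp : ∀ u v, T.Adj u v → p u ≠ p v → p v = p u + 1)
    (htr : ∀ u v w, p u = p v → p v = p w → T.Adj u v → T.Adj v w → T.Adj u w) :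
    ∃ a b c : ℕ, DigraphIso T (cyclicTournament a b c) ∧ ((∃ v, p v = 0) → 1 ≤ a) ∧
      ((∃ v, p v = 1) → 1 ≤ b) := by
  classical
  have hclass : ∀ k : ZMod 3, ∃ (n : ℕ) (f : Fin n → V), ((∃ v, p v = k) → 1 ≤ n) ∧
      (∀ i, p (f i) = k) ∧ (∀ v, p v = k → ∃ i, f i = v) ∧
      ∀ i j, T.Adj (f i) (f j) ↔ i < j := by
    intro k
    let S : Digraph {v : V // p v = k} := ⟨fun u v => T.Adj u v⟩
    have hS : IsTournament S :=
      ⟨fun v => hT.loopless v, fun u v huv => hT.oriented u v (Subtype.coe_ne_coe.2 huv)⟩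
    have hSt : IsTransitiveDigraph S := fun u v w h1 h2 =>
      htr u v w (u.2.trans v.2.symm) (v.2.trans w.2.symm) h1 h2
    obtain ⟨e⟩ := hS.nonempty_relIso_fin hSt
    refine ⟨_, fun i => (e.symm i : V), fun ⟨v, hv⟩ => ?_, fun i => (e.symm i).2,
      fun v hv => ⟨e ⟨v, hv⟩, by simp⟩, fun i j => e.symm.map_rel_iff⟩
    exact Fintype.card_pos_iff.2 ⟨⟨v, hv⟩⟩
  have hcyc : ∀ u v, p v = p u + 1 → T.Adj u v ∧ ¬ T.Adj v u := by
    intro u v huv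
    have h3 : ∀ x : ZMod 3, x ≠ x + 1 ∧ x ≠ x + 1 + 1 := by decide
    have hne : p u ≠ p v := fun h => (h3 (p u)).1 (h.trans huv)
    have hnot : ¬ T.Adj v u := fun h => by
      have h1 := hp v u h hne.symm
      rw [huv] at h1
      exact (h3 (p u)).2 h1
    rcases hT.oriented u v (fun h => hne (h ▸ rfl)) with ⟨h, _⟩ | ⟨h, _⟩
    · exact ⟨h, hnot⟩
    · exact absurd h hnot
  obtain ⟨a, f, ha, hf, hfs, hfa⟩ := hclass 0
  obtain ⟨b, g, hb, hg, hgs, hga⟩ := hclass 1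
  obtain ⟨c, h, -, hh, hhs, hha⟩ := hclass 2
  refine ⟨a, b, c, DigraphIso.symm ?_, ha, hb⟩
  let F : Fin a ⊕ Fin b ⊕ Fin c → V := Sum.elim f (Sum.elim g h)
  have hadj : ∀ s t, T.Adj (F s) (F t) ↔ (cyclicTournament a b c).Adj s t := by
    have h01 : ∀ i j, T.Adj (f i) (g j) ∧ ¬ T.Adj (g j) (f i) := fun i j =>
      hcyc _ _ (by rw [hf, hg]; decide)
    have h12 : ∀ i j, T.Adj (g i) (h j) ∧ ¬ T.Adj (h j) (g i) := fun i j =>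
      hcyc _ _ (by rw [hg, hh]; decide)
    have h20 : ∀ i j, T.Adj (h i) (f j) ∧ ¬ T.Adj (f j) (h i) := fun i j =>
      hcyc _ _ (by rw [hh, hf]; decide)
    rintro (i | i | i) (j | j | j) <;>
      simp [F, cyclicTournament, cyclicBlowup, transitiveParts, hfa, hga, hha, h01, h12, h20]
  have hinj : Function.Injective F := by
    intro s t hst
    by_contra hne
    have hl := hT.loopless (F s)
    rcases (isTournament_cyclicTournament a b c).oriented s t hne with ⟨h', _⟩ | ⟨h', _⟩
    · have h1 := (hadj s t).2 h'
      rw [← hst] at h1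
      exact hl h1
    · have h1 := (hadj t s).2 h'
      rw [← hst] at h1
      exact hl h1
  have hsurj : Function.Surjective F := by
    intro v
    have h3 : ∀ x : ZMod 3, x = 0 ∨ x = 1 ∨ x = 2 := by decide
    rcases h3 (p v) with hv | hv | hv
    · obtain ⟨i, hi⟩ := hfs v hv
      exact ⟨.inl i, hi⟩
    · obtain ⟨i, hi⟩ := hgs v hv
      exact ⟨.inr (.inl i), hi⟩
    · obtain ⟨i, hi⟩ := hhs v hv
      exact ⟨.inr (.inr i), hi⟩
  exact ⟨⟨Equiv.ofBijective F ⟨hinj, hsurj⟩, fun {s t} => hadj s t⟩⟩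

/-- A locally transitive tournament that decomposes as a blow-up of the cyclic triangle, possibly
with one part empty, is some `T[a,b,c]`: each part lies in a neighbourhood of a vertex of another
part, so it is transitive. -/
theorem IsLocallyTransitive.digraphIso_cyclicTournament {V : Type*} [Fintype V] {T : Digraph V}
    (hT : IsTournament T) (hloc : IsLocallyTransitive T) (p : V → ZMod 3)
    (hne : ∃ u v, p u ≠ p v) (hp : ∀ u v, T.Adj u v → p u ≠ p v → p v = p u + 1) :
    ∃ a b c : ℕ, 1 ≤ a ∧ 1 ≤ b ∧ DigraphIso T (cyclicTournament a b c) := by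
  obtain ⟨u, v, huv, hpuv⟩ : ∃ u v, T.Adj u v ∧ p v = p u + 1 := by
    obtain ⟨u, v, h⟩ := hne
    rcases hT.oriented u v (fun h' => h (h' ▸ rfl)) with ⟨h', _⟩ | ⟨h', _⟩
    · exact ⟨u, v, h', hp u v h' h⟩
    · exact ⟨v, u, h', hp v u h' h.symm⟩
  set q : V → ZMod 3 := fun x => p x - p u with hq
  have hqu : q u = 0 := by simp [hq]
  have hqv : q v = 1 := by simp [hq, hpuv]
  have hadj : ∀ x y, q y = q x + 1 → T.Adj x y := by
    intro x y hxy
    have h3 : ∀ t : ZMod 3, t ≠ t + 1 ∧ t ≠ t + 1 + 1 := by decide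
    have hpxy : p y = p x + 1 := by
      simp only [hq] at hxy
      linear_combination hxy
    have hne : p x ≠ p y := fun h => (h3 (p x)).1 (h.trans hpxy)
    rcases hT.oriented x y (fun h => hne (h ▸ rfl)) with ⟨h, _⟩ | ⟨h, _⟩
    · exact h
    · have h1 := hp y x h hne.symm
      rw [hpxy] at h1
      exact absurd h1 (h3 (p x)).2
  obtain ⟨a, b, c, e, ha, hb⟩ := hT.digraphIso_cyclicTournament_of_classes q
    (fun x y hxy hne' => by
      have h1 := hp x y hxy (fun h => hne' (by simp [hq, h]))
      simp only [hq, h1]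
      ring)
    (fun x y z hxy hyz h1 h2 => by
      have h3 : ∀ t : ZMod 3, t + 1 = 1 ∨ t = 0 + 1 ∨ t = 1 + 1 := by decide
      rcases h3 (q x) with h | h | h
      · have key : ∀ t, q t = q x → T.Adj t v := fun t ht => hadj _ _ (by rw [hqv, ht, h])
        exact hloc.into v x y z (key x rfl) (key y hxy.symm) (key z (hxy.trans hyz).symm) h1 h2
      · have key : ∀ t, q t = q x → T.Adj u t := fun t ht => hadj _ _ (by rw [hqu, ht, h])
        exact hloc.out u x y z (key x rfl) (key y hxy.symm) (key z (hxy.trans hyz).symm) h1 h2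
      · have key : ∀ t, q t = q x → T.Adj v t := fun t ht => hadj _ _ (by rw [hqv, ht, h])
        exact hloc.out v x y z (key x rfl) (key y hxy.symm) (key z (hxy.trans hyz).symm) h1 h2)
  exact ⟨a, b, c, ha ⟨u, hqu⟩, hb ⟨v, hqv⟩, e⟩

theorem halfMinimizes_of_isTransitiveDigraph {V : Type*} [Fintype V] {T : Digraph V}
    (hT : IsTournament T) (htr : IsTransitiveDigraph T) (h4 : 4 ≤ Fintype.card V) :
    HalfMinimizes T := by
  obtain ⟨n, hn⟩ := Nat.exists_eq_add_of_le h4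
  refine HalfMinimizes.of_iso ?_ (halfMinimizes_cyclicTournament_zero n)
  refine hT.digraphIso_of_isTransitiveDigraph (isTournament_cyclicTournament _ _ _) htr
    (isTransitiveDigraph_cyclicTournament_zero _ _) ?_
  simp [hn]
  ring

/-! ### Tournaments with at most three vertices -/

theorem lhomDensity_of_card_le_three {V : Type*} [Fintype V] {T : Digraph V}
    (hT : IsTournament T) (h : (IsTransitiveDigraph T ∧ Fintype.card V ≤ 3) ∨
      DigraphIso T (cyclicTournament 1 1 1)) {W : Tournamenton} (hW : W.IsRegular) :
    2 ^ (digraphEdges T).card * lhomDensity T W.kernel = 1 := by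
  have hw := W.isTournamentKernel_kernel
  have hr := Tournamenton.ae_lintegral_kernel hW
  rcases h with ⟨htr, hc⟩ | ⟨⟨e⟩⟩
  · rcases Nat.eq_zero_or_pos (Fintype.card V) with h0 | h0
    · have := Fintype.card_eq_zero_iff.1 h0
      have hE : digraphEdges T = ∅ := Finset.eq_empty_of_isEmpty _
      simp [lhomDensity, hE]
    · obtain ⟨e⟩ : DigraphIso T (cyclicTournament (Fintype.card V - 1) 1 0) :=
        hT.digraphIso_of_isTransitiveDigraph (isTournament_cyclicTournament _ _ _) htr
          (isTransitiveDigraph_cyclicTournament_zero _ _) (by simp; omega)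
      rw [lhomDensity_congr_iso e, card_digraphEdges_congr_iso e,
        card_digraphEdges_cyclicTournament, lhomDensity_cyclicTournament hw]
      exact hw.cyclicDensity_one_zero hr (by omega)
  · rw [lhomDensity_congr_iso e, card_digraphEdges_congr_iso e, card_digraphEdges_cyclicTournament,
      lhomDensity_cyclicTournament hw]
    exact hw.cyclicDensity_one_one hr

/-! ### Unique minimizers -/

theorem not_isUniqueRegularMinimizer_of_small {V : Type*} [Fintype V] {T : Digraph V}
    (hT : IsTournament T) (h : (IsTransitiveDigraph T ∧ Fintype.card V ≤ 3) ∨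
      DigraphIso T (cyclicTournament 1 1 1)) :
    ¬ IsUniqueRegularMinimizer T Tournamenton.half := by
  rintro ⟨-, -, huniq⟩
  obtain ⟨W, hreg, hne, -⟩ := exists_carousel.{0}
  refine hne (huniq W hreg ?_)
  rw [homDensity_half, homDensity_eq_half_pow_iff]
  exact lhomDensity_of_card_le_three hT h hreg

theorem IsUniqueRegularMinimizer.isTransitive_or_cyclic {V : Type*} [Fintype V] {T : Digraph V}
    (hT : IsTournament T) (h : IsUniqueRegularMinimizer T Tournamenton.half) :
    (IsTransitiveDigraph T ∧ 4 ≤ Fintype.card V) ∨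
      ∃ a b c : ℕ, 1 ≤ a ∧ 1 ≤ b ∧ 1 ≤ c ∧ 4 ≤ a + b + c ∧
        DigraphIso T (cyclicTournament a b c) := by
  have hpos : ∀ W : Tournamenton, W.IsRegular → homDensity T W ≠ 0 := fun W hW => by
    have h1 := h.2.1 W hW
    rw [homDensity_half] at h1
    have h2 : (0 : ℝ) < (1 / 2) ^ (digraphEdges T).card := by positivity
    linarith
  have htrans : IsTransitiveDigraph T → 4 ≤ Fintype.card V := fun htr => by
    by_contra hc
    exact not_isUniqueRegularMinimizer_of_small hT (Or.inl ⟨htr, by omega⟩) h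
  rcases subsingleton_or_nontrivial V with hs | hs
  · have htr : IsTransitiveDigraph T := fun u v w huv _ =>
      absurd (Subsingleton.elim u v ▸ huv) (hT.loopless _)
    exact Or.inl ⟨htr, htrans htr⟩
  obtain ⟨W₁, hreg₁, -, hW₁⟩ := exists_carousel
  obtain ⟨W₂, hreg₂, hW₂⟩ := exists_ternary
  obtain ⟨p, hne, hp⟩ := hW₂ T hT (hpos W₂ hreg₂)
  obtain ⟨a, b, c, ha, hb, e⟩ :=
    (hW₁ T hT (hpos W₁ hreg₁)).digraphIso_cyclicTournament hT p hne hp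
  rcases Nat.eq_zero_or_pos c with rfl | hc
  · have htr := (isTransitiveDigraph_cyclicTournament_zero a b).of_iso e
    exact Or.inl ⟨htr, htrans htr⟩
  · refine Or.inr ⟨a, b, c, ha, hb, hc, ?_, e⟩
    by_contra h4
    obtain ⟨rfl, rfl, rfl⟩ : a = 1 ∧ b = 1 ∧ c = 1 := by omega
    exact not_isUniqueRegularMinimizer_of_small hT (Or.inr e) h

theorem mainTheorem1 :
    (∀ (V : Type*) [Fintype V] (T : Digraph V), IsTournament T →
      (IsUniqueRegularMinimizer T Tournamenton.half ↔
        (IsTransitiveDigraph T ∧ 4 ≤ Fintype.card V) ∨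
        ∃ a b c : ℕ, 1 ≤ a ∧ 1 ≤ b ∧ 1 ≤ c ∧ 4 ≤ a + b + c ∧
          DigraphIso T (cyclicTournament a b c))) ∧
    (∀ a b c : ℕ, 1 ≤ a → 1 ≤ b → 1 ≤ c → 4 ≤ a + b + c →
      IsTournament (cyclicTournament a b c) ∧
      ¬ IsTransitiveDigraph (cyclicTournament a b c) ∧
      QuasirandomForcingInRegular (cyclicTournament a b c)) ∧
    {n : ℕ | ∃ T : Digraph (Fin n), IsTournament T ∧ ¬ IsTransitiveDigraph T ∧
      QuasirandomForcingInRegular T}.Infinite := by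
  refine ⟨fun V _ T hT => ⟨fun h => h.isTransitive_or_cyclic hT, ?_⟩, fun a b c ha hb hc habc => ?_,
    Set.infinite_of_injective_forall_mem (f := fun n : ℕ => n + 4) (add_left_injective 4)
      fun n => ?_⟩
  · rintro (⟨htr, h4⟩ | ⟨a, b, c, ha, hb, hc, habc, e⟩)
    · exact (halfMinimizes_of_isTransitiveDigraph hT htr h4).isUniqueRegularMinimizer
    · exact ((halfMinimizes_cyclicTournament ha hb hc habc).of_iso e).isUniqueRegularMinimizer
  · exact ⟨isTournament_cyclicTournament a b c, not_isTransitiveDigraph_cyclicTournament ha hb hc,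
      (halfMinimizes_cyclicTournament ha hb hc habc).quasirandomForcingInRegular
        (isTournament_cyclicTournament a b c)⟩
  · let f : Fin (n + 4) ≃ Fin (n + 2) ⊕ Fin 1 ⊕ Fin 1 :=
      Fintype.equivOfCardEq (by simp)
    let T : Digraph (Fin (n + 4)) := ⟨fun u v => (cyclicTournament (n + 2) 1 1).Adj (f u) (f v)⟩
    have e : DigraphIso T (cyclicTournament (n + 2) 1 1) := ⟨⟨f, Iff.rfl⟩⟩
    have hC := isTournament_cyclicTournament (n + 2) 1 1
    have hT : IsTournament T :=
      ⟨fun v => hC.loopless _, fun u v huv => hC.oriented _ _ (f.injective.ne huv)⟩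
    refine ⟨T, hT, fun htr => ?_, ?_⟩
    · exact not_isTransitiveDigraph_cyclicTournament (by omega) le_rfl le_rfl (htr.of_iso e.symm)
    · exact ((halfMinimizes_cyclicTournament (by omega) le_rfl le_rfl
        (by omega)).of_iso e).quasirandomForcingInRegular hT
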